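/- Let $d\ge 1$ and $k\ge 1$ be integers, let $\|\cdot\|$ be any norm on $\mathbf R^d$, and let $X_1,X_2,\dots$ be i.i.d. $\mathbf R^d$-valued random variables whose law has an (essentially) bounded density $f$ with respect to Lebesgue measure. For a finite set $s\subset\mathbf R^d$ and $r>0$, let $G(s;r)$ be the graph with vertex set $s$ in which two distinct points $x,y$ are joined by an edge if and only if $\|x-y\|\le r$. Put $\mathcal X_n=\{X_1,\dots,X_n\}$ and $$S_k(\mathcal X_n)=\inf\{r>0:\ \text{the maximum degree of } G(\mathcal X_n;r) \text{ is at least } k\}$$ (for $n\le k$ the set is empty, and the value given to $S_k(\mathcal X_n)$ is immaterial). For a simple graph $\Gamma$ with $j\ge 2$ vertices let $$\mu_\Gamma=\frac1{j!}\int_{\mathbf R^d} f(x)^j\,dx\int_{(\mathbf R^d)^{j-1}}\mathbf 1\{G(\{0,x_1,\dots,x_{j-1}\};1)\cong\Gamma\}\,dx_1\cdots dx_{j-1}\in[0,\infty],$$ and call $\Gamma$ feasible if $\mu_\Gamma\ne 0$. Let $\Gamma_1,\dots,\Gamma_m$ be all the feasible graphs, up to isomorphism and without repetition, that have $k+1$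 vertices and at least one vertex of degree $k$, and let $\mu_{d,k}=\sum_{i=1}^m\mu_{\Gamma_i}$. Then $0<\mu_{d,k}<\infty$ and, as $n\to\infty$, $$-n^{(k+1)/(dk)}\,S_k(\mathcal X_n)\ \xrightarrow{d}\ Z_{d,k},$$ where $Z_{d,k}$ is a random variable with the (negative) Weibull distribution $$P[Z_{d,k}\le x]=\begin{cases}\exp\left(-\mu_{d,k}(-x)^{dk}\right)& (x<0),\\ 1&(x\ge 0).\end{cases}$$ -/

import Mathlib

open MeasureTheory ProbabilityTheory Filter Topology
open scoped ENNReal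

noncomputable section

namespace RandomGeometricGraph

variable {d : ℕ}

/-- The geometric graph `G(s; r)` for a norm `N` on `ℝ^d`: the vertices are the points of the finite
set `s`, and two distinct vertices are joined exactly when their `N`-distance is at most `r`. -/
def geometricGraph (N : Seminorm ℝ (Fin d → ℝ)) (s : Finset (Fin d → ℝ)) (r : ℝ) :
    SimpleGraph s where
  Adj x y := x ≠ y ∧ N ((x : Fin d → ℝ) - (y : Fin d → ℝ)) ≤ r
  symm := ⟨fun _ _ h => ⟨h.1.symm, by rw [map_sub_rev]; exact h.2⟩⟩
  loopless := ⟨fun _ h => h.1 rfl⟩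

open Classical in
/-- The threshold radius `inf {r > 0 : the maximum degree of G(s; r) is at least k}`. If `s` has
at most `k` points then (for `k ≥ 1`) the set is empty and the value is the default `0`; otherwise
the set is nonempty and bounded below, and this is its genuine infimum. -/
def thresholdRadius (N : Seminorm ℝ (Fin d → ℝ)) (k : ℕ) (s : Finset (Fin d → ℝ)) : ℝ :=
  sInf {r : ℝ | 0 < r ∧ k ≤ (geometricGraph N s r).maxDegree}

open Classical in
/-- The set of points (support) of the binomial process `δ_{X_0} + ⋯ + δ_{X_{n-1}}`. -/
def binomialPoints {Ω : Type*} (X : ℕ → Ω → (Fin d → ℝ)) (n : ℕ) (ω : Ω) :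
    Finset (Fin d → ℝ) :=
  (Finset.range n).image fun i => X i ω

open Classical in
/-- `h_Γ(s)` is `1` if `G(s; 1)` is isomorphic to `Γ`, and `0` otherwise. -/
def isoIndicator (N : Seminorm ℝ (Fin d → ℝ)) {V : Type*} (Γ : SimpleGraph V)
    (s : Finset (Fin d → ℝ)) : ℝ≥0∞ :=
  if Nonempty (geometricGraph N s 1 ≃g Γ) then 1 else 0

open Classical in
/-- For a graph `Γ` on `j = l + 1` vertices and a density `f` on `ℝ^d`,
`μ_Γ = (1 / j!) ∫ f(x)^j dx ∫_{(ℝ^d)^{j-1}} h_Γ({0, y_1, …, y_{j-1}}) dy_1 ⋯ dy_{j-1}`,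
as an element of `[0, ∞]`. -/
def graphMass (N : Seminorm ℝ (Fin d → ℝ)) (f : (Fin d → ℝ) → ℝ) {l : ℕ}
    (Γ : SimpleGraph (Fin (l + 1))) : ℝ≥0∞ :=
  ((l + 1).factorial : ℝ≥0∞)⁻¹ * (∫⁻ x : Fin d → ℝ, ENNReal.ofReal (f x) ^ (l + 1)) *
    ∫⁻ y : Fin l → (Fin d → ℝ), isoIndicator N Γ (insert 0 (Finset.univ.image y))

/-- `Γ` is feasible if `μ_Γ ≠ 0`. -/
def Feasible (N : Seminorm ℝ (Fin d → ℝ)) (f : (Fin d → ℝ) → ℝ) {l : ℕ}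
    (Γ : SimpleGraph (Fin (l + 1))) : Prop :=
  graphMass N f Γ ≠ 0

/-- Isomorphism of graphs on the vertex set `Fin j`. -/
def isoSetoid (j : ℕ) : Setoid (SimpleGraph (Fin j)) where
  r G H := Nonempty (G ≃g H)
  iseqv := ⟨fun _ => ⟨SimpleGraph.Iso.refl⟩, fun ⟨e⟩ => ⟨e.symm⟩,
    fun ⟨e⟩ ⟨e'⟩ => ⟨e.trans e'⟩⟩

/-- `μ_Γ` depends only on the isomorphism class of `Γ`. -/
theorem graphMass_congr (N : Seminorm ℝ (Fin d → ℝ)) (f : (Fin d → ℝ) → ℝ) {l : ℕ}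
    {Γ Γ' : SimpleGraph (Fin (l + 1))} (e : Γ ≃g Γ') : graphMass N f Γ = graphMass N f Γ' := by
  have h : ∀ s : Finset (Fin d → ℝ), isoIndicator N Γ s = isoIndicator N Γ' s := by
    intro s
    have : Nonempty (geometricGraph N s 1 ≃g Γ) ↔ Nonempty (geometricGraph N s 1 ≃g Γ') :=
      ⟨fun ⟨a⟩ => ⟨a.trans e⟩, fun ⟨a⟩ => ⟨a.trans e.symm⟩⟩
    by_cases hs : Nonempty (geometricGraph N s 1 ≃g Γ)
    · rw [isoIndicator, isoIndicator, if_pos hs, if_pos (this.mp hs)]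
    · rw [isoIndicator, isoIndicator, if_neg hs, if_neg fun h => hs (this.mpr h)]
  simp only [graphMass, h]

open Classical in
/-- A complete list, without repetition up to isomorphism, of the feasible graphs on `k + 1`
vertices that have at least one vertex of degree `k`: one representative is taken from each
isomorphism class of graphs on `Fin (k + 1)`. -/
def feasibleGraphs (N : Seminorm ℝ (Fin d → ℝ)) (f : (Fin d → ℝ) → ℝ) (k : ℕ) :
    Finset (SimpleGraph (Fin (k + 1))) :=
  (Finset.univ.image fun c : Quotient (isoSetoid (k + 1)) => c.out).filter
    fun Γ => Feasible N f Γ ∧ ∃ v, Γ.degree v = k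

/-- `μ_{d,k}`, the sum of `μ_Γ` over the graphs in `feasibleGraphs`. -/
def totalMass (N : Seminorm ℝ (Fin d → ℝ)) (f : (Fin d → ℝ) → ℝ) (k : ℕ) : ℝ≥0∞ :=
  ∑ Γ ∈ feasibleGraphs N f k, graphMass N f Γ

end RandomGeometricGraph

end

/-!
# The threshold radius for a vertex of degree `k` in a random geometric graph

Call a set of `k + 1` of the points a *star of radius `r`* if one of its points is within distance
`r` of all the others. Almost surely the points are distinct, and then `S_k(𝒳_n) ≤ r` says exactly
that some `k + 1` of the first `n` points form a star of radius `r` (`thresholdRadius_le_iff`). The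
theorem is thus a statement about the number `W` of stars of radius `r_n = t n ^ (-(k + 1) / (d k))`:
it has to be shown that `P(W = 0) → exp (-μ_{d,k} t ^ (d k))`.

**Mean.** The substitution `x_i = x_0 + r y_i` turns the probability that `k + 1` independent points
form a star into `r ^ (d k)` times an integral of `f x ∏ f (x + r y_i)` over all `x` and over the
configurations `(0, y)` that form a star of radius `1` (`pi_hasCenter_eq`). Since `f` is bounded and
translations are continuous in `L¹`, the integral tends to `∫ f ^ (k + 1)` times the volume of those
configurations (`tendsto_pi_hasCenter_div`). Sorting these by the isomorphism class of their graph
shows that the limit is `(k + 1)! μ_{d,k}` (`totalMass_eq`), so `E W → μ_{d,k} t ^ (d k)`.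

**Poisson approximation.** Two star events on disjoint index sets are independent. For such locally
dependent events, `|P(W = 0) - exp (-E W)|` is at most the sum of `P(E_α) P(E_β)` over intersecting
`α`, `β`, plus the sum of `P(E_α ∩ E_β)` over intersecting `α ≠ β`
(`abs_measureReal_sub_exp_le`). This follows from the differential inequality `|ψ' - λ ψ| ≤ ε` for
the generating function `ψ u = E[u ^ W]`. A pair with `|α ∪ β| = m` confines `m` points to a ball of
radius `2 r_n`, which has probability of order `r_n ^ (d (m - 1))`. There are of order `n ^ m` such
pairs, and `n ^ m r_n ^ (d (m - 1))` is a constant times `(n r_n ^ d) ^ (m - k - 1)`, which tends to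
`0` for `m ≥ k + 2`. The products `P(E_α) P(E_β)` add up to `O(n ^ (2 k + 1) n ^ (-2 (k + 1)))`.
These estimates are combined in `tendsto_measureReal_no_star`.

**Conclusion.** The limiting distribution function is continuous, so the limits of `P(S_k > r_n)`
determine those of the distribution functions, and convergence of the latter gives weak convergence
by way of the π-system of intervals `(a, b]`.
-/

namespace RandomGeometricGraph

/-! ### Poisson approximation for locally dependent events -/

section PoissonApproximation

variable {Ω ι : Type*}

/-- The number of events `E β`, `β ∈ S`, that occur at `ω`. -/
noncomputable def eventCount (S : Finset ι) (E : ι → Set Ω) (ω : Ω) : ℕ :=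
  ∑ β ∈ S, (E β).indicator 1 ω

theorem eventCount_eq_zero_iff (S : Finset ι) (E : ι → Set Ω) (ω : Ω) :
    eventCount S E ω = 0 ↔ ∀ β ∈ S, ω ∉ E β := by
  simp [eventCount, Finset.sum_eq_zero_iff]

theorem eventCount_le_card (S : Finset ι) (E : ι → Set Ω) (ω : Ω) :
    eventCount S E ω ≤ S.card := by
  classical
  rw [eventCount, Finset.card_eq_sum_ones]
  exact Finset.sum_le_sum fun β _ => by by_cases h : ω ∈ E β <;> simp [h]

variable [MeasurableSpace Ω]

theorem measurable_eventCount {S : Finset ι} {E : ι → Set Ω}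
    (hE : ∀ β ∈ S, MeasurableSet (E β)) : Measurable (eventCount S E) :=
  Finset.measurable_fun_sum S fun β hβ => measurable_one.indicator (hE β hβ)

theorem integral_eventCount (P : Measure Ω) [IsFiniteMeasure P] {S : Finset ι} {E : ι → Set Ω}
    (hE : ∀ β ∈ S, MeasurableSet (E β)) :
    ∫ ω, (eventCount S E ω : ℝ) ∂P = ∑ β ∈ S, P.real (E β) := by
  have h : ∀ ω, (eventCount S E ω : ℝ) = ∑ β ∈ S, (E β).indicator (fun _ => (1 : ℝ)) ω := by
    intro ω
    rw [eventCount, Nat.cast_sum]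
    exact Finset.sum_congr rfl fun β _ => by by_cases h : ω ∈ E β <;> simp [h]
  simp_rw [h]
  rw [integral_finsetSum _ fun β hβ => (integrable_const 1).indicator (hE β hβ)]
  exact Finset.sum_congr rfl fun β hβ => by simp [integral_indicator (hE β hβ)]

/-- The generating function of a bounded random variable with values in `ℕ` may be differentiated
under the expectation. -/
theorem hasDerivAt_integral_pow (P : Measure Ω) [IsProbabilityMeasure P] {W : Ω → ℕ}
    (hW : Measurable W) {M : ℕ} (hM : ∀ ω, W ω ≤ M) (u : ℝ) :
    HasDerivAt (fun v : ℝ => ∫ ω, v ^ W ω ∂P) (∫ ω, (W ω : ℝ) * u ^ (W ω - 1) ∂P) u := by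
  have hmeas : ∀ v : ℝ, Measurable fun ω => v ^ W ω := fun v =>
    (measurable_from_nat (f := fun n : ℕ => v ^ n)).comp hW
  have hb : ∀ v : ℝ, ∀ n ≤ M, |v| ^ n ≤ (|v| + 1) ^ M := fun v n hn =>
    (pow_le_pow_left₀ (abs_nonneg v) (by linarith) n).trans
      (pow_le_pow_right₀ (by linarith [abs_nonneg v]) hn)
  refine (hasDerivAt_integral_of_dominated_loc_of_deriv_le
    (bound := fun _ => (M : ℝ) * (|u| + 2) ^ M)
    (F' := fun v ω => (W ω : ℝ) * v ^ (W ω - 1)) (Metric.ball_mem_nhds u one_pos) ?_ ?_ ?_ ?_ ?_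
    ?_).2
  · exact Eventually.of_forall fun v => (hmeas v).aestronglyMeasurable
  · refine Integrable.of_bound (hmeas u).aestronglyMeasurable ((|u| + 1) ^ M)
      (Eventually.of_forall fun ω => ?_)
    rw [norm_pow, Real.norm_eq_abs]
    exact hb u _ (hM ω)
  · exact ((measurable_from_nat (f := fun n : ℕ => (n : ℝ) * u ^ (n - 1))).comp
      hW).aestronglyMeasurable
  · refine Eventually.of_forall fun ω v hv => ?_
    rw [Metric.mem_ball, Real.dist_eq] at hv
    have hv' : |v| ≤ |u| + 1 := by
      have := abs_sub_abs_le_abs_sub v u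
      linarith
    rw [norm_mul, norm_pow, Real.norm_eq_abs, Real.norm_eq_abs, Nat.abs_cast]
    have h1 : (W ω : ℝ) ≤ M := by exact_mod_cast hM ω
    have h2 : |v| ^ (W ω - 1) ≤ (|u| + 2) ^ M :=
      (hb v _ ((Nat.sub_le _ _).trans (hM ω))).trans
        (pow_le_pow_left₀ (by positivity) (by linarith) _)
    exact mul_le_mul h1 h2 (by positivity) (by positivity)
  · exact integrable_const _
  · exact Eventually.of_forall fun ω v _ => hasDerivAt_pow (W ω) v

theorem abs_pow_add_sub_pow_le {u : ℝ} (h0 : 0 ≤ u) (h1 : u ≤ 1) (a b : ℕ) :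
    |u ^ (a + b) - u ^ a| ≤ b := by
  rcases Nat.eq_zero_or_pos b with rfl | hb
  · simp
  · have ha : 0 ≤ u ^ a := pow_nonneg h0 a
    have hab : 0 ≤ u ^ (a + b) := pow_nonneg h0 _
    have ha1 : u ^ a ≤ 1 := pow_le_one₀ h0 h1
    have hab1 : u ^ (a + b) ≤ 1 := pow_le_one₀ h0 h1
    have : (1 : ℝ) ≤ b := by exact_mod_cast hb
    rw [abs_le]
    constructor <;> linarith

/-- One summand of `E[W u ^ (W - 1)] - λ E[u ^ W]`. The event `E α` is independent of the number
`W'` of occurring events outside its neighbourhood, so `E[1_{E α} u ^ W'] = P(E α) E[u ^ W']`, and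
`W - 1` (on `E α`) and `W` differ from `W'` only by events in the neighbourhood. -/
theorem abs_integral_local_term_le (P : Measure Ω) [IsProbabilityMeasure P] [DecidableEq ι]
    (S : Finset ι) (E : ι → Set Ω) (hE : ∀ β ∈ S, MeasurableSet (E β)) (R : ι → ι → Prop)
    [DecidableRel R] {α : ι} (hα : α ∈ S) (hR : R α α)
    (hind : IndepFun ((E α).indicator (1 : Ω → ℕ))
      (eventCount (S.filter fun β => ¬ R α β) E) P) {u : ℝ} (h0 : 0 ≤ u) (h1 : u ≤ 1) :
    |∫ ω, ((E α).indicator (1 : Ω → ℝ) ω * u ^ (eventCount S E ω - 1)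
        - P.real (E α) * u ^ eventCount S E ω) ∂P| ≤
      P.real (E α) * (∑ β ∈ S.filter (R α), P.real (E β)) +
        ∑ β ∈ (S.filter (R α)).erase α, P.real (E α ∩ E β) := by
  set W := eventCount S E with hW
  set W' := eventCount (S.filter fun β => ¬ R α β) E with hW'
  set V := eventCount ((S.filter (R α)).erase α) E with hV
  set Z := eventCount (S.filter (R α)) E with hZ
  have hEα := hE α hα
  have hαR : α ∈ S.filter (R α) := Finset.mem_filter.2 ⟨hα, hR⟩
  have hsplit : ∀ ω, W ω = W' ω + Z ω := fun ω => by
    simp only [hW, hW', hZ, eventCount]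
    rw [add_comm, Finset.sum_filter_add_sum_filter_not]
  have hZV : ∀ ω, Z ω = V ω + (E α).indicator 1 ω := fun ω => by
    simp only [hZ, hV, eventCount]
    rw [Finset.sum_erase_add _ _ hαR]
  have mW' : Measurable W' :=
    measurable_eventCount fun β hβ => hE β (Finset.mem_of_mem_filter β hβ)
  have mW : Measurable W := measurable_eventCount hE
  have mY : Measurable ((E α).indicator (1 : Ω → ℝ)) := measurable_one.indicator hEα
  have mpow : ∀ {T : Ω → ℕ}, Measurable T → Measurable fun ω => u ^ T ω := fun hT =>
    (measurable_from_nat (f := fun n : ℕ => u ^ n)).comp hT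
  have bpow : ∀ n : ℕ, ‖u ^ n‖ ≤ 1 := fun n => by
    rw [Real.norm_of_nonneg (pow_nonneg h0 n)]; exact pow_le_one₀ h0 h1
  have bY : ∀ ω, ‖(E α).indicator (1 : Ω → ℝ) ω‖ ≤ 1 := fun ω => by
    by_cases h : ω ∈ E α <;> simp [h]
  have ipow : ∀ {T : Ω → ℕ}, Measurable T → Integrable (fun ω => u ^ T ω) P := fun hT =>
    Integrable.of_bound (mpow hT).aestronglyMeasurable 1 (Eventually.of_forall fun ω => bpow _)
  have iYpow : ∀ {T : Ω → ℕ}, Measurable T →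
      Integrable (fun ω => (E α).indicator (1 : Ω → ℝ) ω * u ^ T ω) P := fun hT =>
    Integrable.of_bound (mY.mul (mpow hT)).aestronglyMeasurable 1
      (Eventually.of_forall fun ω => by
        rw [norm_mul]; exact mul_le_one₀ (bY ω) (norm_nonneg _) (bpow _))
  have icount : ∀ (T : Finset ι), (∀ β ∈ T, MeasurableSet (E β)) →
      Integrable (fun ω => (eventCount T E ω : ℝ)) P := fun T hT =>
    Integrable.of_bound
      (((measurable_from_nat (f := fun n : ℕ => (n : ℝ))).comp
        (measurable_eventCount hT)).aestronglyMeasurable) T.card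
      (Eventually.of_forall fun ω => by
        rw [Real.norm_of_nonneg (Nat.cast_nonneg _)]
        exact_mod_cast eventCount_le_card T E ω)
  -- the factorisation given by independence
  have hfac : ∫ ω, (E α).indicator (1 : Ω → ℝ) ω * u ^ W' ω ∂P
      = P.real (E α) * ∫ ω, u ^ W' ω ∂P := by
    have hi : IndepFun ((fun n : ℕ => (n : ℝ)) ∘ (E α).indicator (1 : Ω → ℕ))
        ((fun n : ℕ => u ^ n) ∘ W') P := hind.comp measurable_from_nat measurable_from_nat
    have := hi.integral_fun_mul_eq_mul_integral
      (((measurable_from_nat (f := fun n : ℕ => (n : ℝ))).comp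
        (measurable_one.indicator hEα)).aestronglyMeasurable)
      ((mpow mW').aestronglyMeasurable)
    have hY : ∀ ω, (((E α).indicator (1 : Ω → ℕ) ω : ℕ) : ℝ)
        = (E α).indicator (1 : Ω → ℝ) ω := fun ω => by
      by_cases h : ω ∈ E α <;> simp [h]
    simp only [Function.comp_def, hY] at this
    rw [this, integral_indicator_one hEα]
  have mW1 : Measurable fun ω => W ω - 1 := (measurable_from_nat (f := fun n : ℕ => n - 1)).comp mW
  have key : ∫ ω, ((E α).indicator (1 : Ω → ℝ) ω * u ^ (W ω - 1) - P.real (E α) * u ^ W ω) ∂P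
      = ∫ ω, ((E α).indicator (1 : Ω → ℝ) ω * u ^ (W ω - 1)
            - (E α).indicator (1 : Ω → ℝ) ω * u ^ W' ω) ∂P
        - P.real (E α) * ∫ ω, (u ^ W ω - u ^ W' ω) ∂P := by
    rw [integral_sub (iYpow mW1) ((ipow mW).const_mul _), integral_sub (iYpow mW1) (iYpow mW'),
      integral_sub (ipow mW) (ipow mW'), hfac, integral_const_mul]
    ring
  rw [key]
  have e1 : |∫ ω, ((E α).indicator (1 : Ω → ℝ) ω * u ^ (W ω - 1)
            - (E α).indicator (1 : Ω → ℝ) ω * u ^ W' ω) ∂P|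
      ≤ ∑ β ∈ (S.filter (R α)).erase α, P.real (E α ∩ E β) := by
    have hint : ∑ β ∈ (S.filter (R α)).erase α, P.real (E α ∩ E β)
        = ∫ ω, (eventCount ((S.filter (R α)).erase α) (fun β => E α ∩ E β) ω : ℝ) ∂P :=
      (integral_eventCount P fun β hβ => hEα.inter
        (hE β (Finset.mem_of_mem_filter β (Finset.mem_of_mem_erase hβ)))).symm
    rw [hint, ← Real.norm_eq_abs]
    refine norm_integral_le_of_norm_le ?_ (Eventually.of_forall fun ω => ?_)
    · refine Integrable.of_bound (((measurable_from_nat (f := fun n : ℕ => (n : ℝ))).comp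
        (measurable_eventCount fun β hβ => hEα.inter (hE β
          (Finset.mem_of_mem_filter β (Finset.mem_of_mem_erase hβ))))).aestronglyMeasurable)
        ((S.filter (R α)).erase α).card (Eventually.of_forall fun ω => ?_)
      rw [Real.norm_of_nonneg (Nat.cast_nonneg _)]
      exact_mod_cast eventCount_le_card _ _ ω
    · by_cases h : ω ∈ E α
      · have hW1 : W ω - 1 = W' ω + V ω := by
          have := hsplit ω
          have := hZV ω
          simp only [h, Set.indicator_of_mem, Pi.one_apply] at this
          omega
        have hVe : eventCount ((S.filter (R α)).erase α) (fun β => E α ∩ E β) ω = V ω := by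
          simp only [hV, eventCount]
          refine Finset.sum_congr rfl fun β _ => ?_
          by_cases hb : ω ∈ E β <;> simp [h, hb]
        rw [hVe, hW1]
        simpa [h] using abs_pow_add_sub_pow_le h0 h1 (W' ω) (V ω)
      · simp [h]
  have e2 : |∫ ω, (u ^ W ω - u ^ W' ω) ∂P| ≤ ∑ β ∈ S.filter (R α), P.real (E β) := by
    rw [← integral_eventCount P fun β hβ => hE β (Finset.mem_of_mem_filter β hβ),
      ← Real.norm_eq_abs]
    refine norm_integral_le_of_norm_le
      (icount _ fun β hβ => hE β (Finset.mem_of_mem_filter β hβ)) (Eventually.of_forall fun ω => ?_)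
    rw [hsplit ω]
    exact abs_pow_add_sub_pow_le h0 h1 (W' ω) (Z ω)
  refine (abs_sub _ _).trans ?_
  rw [abs_mul, abs_of_nonneg measureReal_nonneg, add_comm]
  exact add_le_add (mul_le_mul_of_nonneg_left e2 measureReal_nonneg) e1

/-- **Poisson approximation for the probability that none of finitely many locally dependent events
occurs.** With `ψ u = E[u ^ W]`, the two sums bound `|ψ' - λ ψ|` on `[0, 1]`; the mean value
inequality for `e ^ (-λ u) ψ u` then compares `ψ 0 = P(W = 0)` with `e ^ (-λ) ψ 1 = e ^ (-λ)`. -/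
theorem abs_measureReal_sub_exp_le (P : Measure Ω) [IsProbabilityMeasure P] [DecidableEq ι]
    (S : Finset ι) (E : ι → Set Ω) (hE : ∀ β ∈ S, MeasurableSet (E β)) (R : ι → ι → Prop)
    [DecidableRel R] (hR : ∀ α ∈ S, R α α)
    (hind : ∀ α ∈ S, IndepFun ((E α).indicator (1 : Ω → ℕ))
      (eventCount (S.filter fun β => ¬ R α β) E) P) :
    |P.real {ω | ∀ β ∈ S, ω ∉ E β} - Real.exp (-∑ α ∈ S, P.real (E α))| ≤
      (∑ α ∈ S, ∑ β ∈ S.filter (R α), P.real (E α) * P.real (E β)) +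
        ∑ α ∈ S, ∑ β ∈ (S.filter (R α)).erase α, P.real (E α ∩ E β) := by
  set W := eventCount S E with hW
  set lam := ∑ α ∈ S, P.real (E α) with hlam
  set ε := (∑ α ∈ S, ∑ β ∈ S.filter (R α), P.real (E α) * P.real (E β)) +
        ∑ α ∈ S, ∑ β ∈ (S.filter (R α)).erase α, P.real (E α ∩ E β) with hε
  have mW : Measurable W := measurable_eventCount hE
  have hlam0 : 0 ≤ lam := Finset.sum_nonneg fun _ _ => measureReal_nonneg
  have hder := hasDerivAt_integral_pow P mW (eventCount_le_card S E)
  have hbound : ∀ u ∈ Set.Icc (0 : ℝ) 1,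
      |(∫ ω, (W ω : ℝ) * u ^ (W ω - 1) ∂P) - lam * ∫ ω, u ^ W ω ∂P| ≤ ε := by
    rintro u ⟨h0, h1⟩
    have mpow : ∀ {T : Ω → ℕ}, Measurable T → Measurable fun ω => u ^ T ω := fun hT =>
      (measurable_from_nat (f := fun n : ℕ => u ^ n)).comp hT
    have bpow : ∀ n : ℕ, ‖u ^ n‖ ≤ 1 := fun n => by
      rw [Real.norm_of_nonneg (pow_nonneg h0 n)]; exact pow_le_one₀ h0 h1
    have iW : Integrable (fun ω => u ^ W ω) P :=
      Integrable.of_bound (mpow mW).aestronglyMeasurable 1 (Eventually.of_forall fun ω => bpow _)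
    have mW1 : Measurable fun ω => W ω - 1 := (measurable_from_nat (f := fun n : ℕ => n - 1)).comp mW
    have iY : ∀ α ∈ S, Integrable
        (fun ω => (E α).indicator (1 : Ω → ℝ) ω * u ^ (W ω - 1)) P := fun α hα =>
      Integrable.of_bound
        ((measurable_one.indicator (hE α hα)).mul (mpow mW1)).aestronglyMeasurable 1
        (Eventually.of_forall fun ω => by
          rw [norm_mul]
          refine mul_le_one₀ ?_ (norm_nonneg _) (bpow _)
          by_cases h : ω ∈ E α <;> simp [h])
    have hsum : (∫ ω, (W ω : ℝ) * u ^ (W ω - 1) ∂P) - lam * ∫ ω, u ^ W ω ∂P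
        = ∑ α ∈ S, ∫ ω, ((E α).indicator (1 : Ω → ℝ) ω * u ^ (W ω - 1)
            - P.real (E α) * u ^ W ω) ∂P := by
      rw [← integral_finsetSum S (f := fun α ω => (E α).indicator (1 : Ω → ℝ) ω * u ^ (W ω - 1)
        - P.real (E α) * u ^ W ω) fun α hα => (iY α hα).sub (iW.const_mul _)]
      simp_rw [Finset.sum_sub_distrib]
      rw [integral_sub (integrable_finsetSum _ iY)
        (integrable_finsetSum _ fun α _ => iW.const_mul _)]
      congr 1
      · refine integral_congr_ae (Eventually.of_forall fun ω => ?_)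
        simp only
        rw [← Finset.sum_mul]
        congr 1
        simp only [hW, eventCount, Nat.cast_sum]
        exact Finset.sum_congr rfl fun β _ => by by_cases h : ω ∈ E β <;> simp [h]
      · rw [← integral_const_mul]
        simp_rw [hlam, Finset.sum_mul]
    rw [hsum]
    refine (Finset.abs_sum_le_sum_abs _ _).trans ?_
    rw [hε, ← Finset.sum_add_distrib]
    refine Finset.sum_le_sum fun α hα => ?_
    rw [← Finset.mul_sum]
    exact abs_integral_local_term_le P S E hE R hα (hR α hα) (hind α hα) h0 h1
  have hexp : ∀ u : ℝ, HasDerivAt (fun v : ℝ => Real.exp (-(lam * v)))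
      (Real.exp (-(lam * u)) * (-lam)) u := fun u => by
    have h : HasDerivAt (fun v : ℝ => -(lam * v)) (-lam) u := by
      simpa using (hasDerivAt_id' u).const_mul (-lam)
    exact h.exp
  have hmv := (convex_Icc (0 : ℝ) 1).norm_image_sub_le_of_norm_hasDerivWithin_le
    (f := fun v : ℝ => Real.exp (-(lam * v)) * ∫ ω, v ^ W ω ∂P) (C := ε)
    (fun u _ => ((hexp u).mul (hder u)).hasDerivWithinAt) (fun u hu => by
      have : Real.exp (-(lam * u)) * (-lam) * (∫ ω, u ^ W ω ∂P)
          + Real.exp (-(lam * u)) * ∫ ω, (W ω : ℝ) * u ^ (W ω - 1) ∂P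
          = Real.exp (-(lam * u)) *
            ((∫ ω, (W ω : ℝ) * u ^ (W ω - 1) ∂P) - lam * ∫ ω, u ^ W ω ∂P) := by ring
      rw [this, norm_mul, Real.norm_of_nonneg (Real.exp_pos _).le, Real.norm_eq_abs]
      have he : Real.exp (-(lam * u)) ≤ 1 :=
        Real.exp_le_one_iff.2 (neg_nonpos.2 (mul_nonneg hlam0 hu.1))
      calc _ ≤ 1 * ε := mul_le_mul he (hbound u hu) (abs_nonneg _) zero_le_one
        _ = ε := one_mul ε)
    (Set.right_mem_Icc.2 zero_le_one) (Set.left_mem_Icc.2 zero_le_one)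
  have hzero : ∫ ω, (0 : ℝ) ^ W ω ∂P = P.real {ω | ∀ β ∈ S, ω ∉ E β} := by
    have hs : {ω | ∀ β ∈ S, ω ∉ E β} = W ⁻¹' {0} := by
      ext ω
      simp [hW, eventCount_eq_zero_iff]
    rw [hs, ← integral_indicator_one (mW (measurableSet_singleton 0))]
    refine integral_congr_ae (Eventually.of_forall fun ω => ?_)
    by_cases h : W ω = 0 <;> simp [h]
  simpa [hzero] using hmv

end PoissonApproximation

/-! ### Densities and iterated integrals for product measures -/

section ProductMeasures

theorem lintegral_fin_prod_eq_prod {α : Type*} [MeasurableSpace α] {n : ℕ} (μ : Fin n → Measure α)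
    [∀ i, SigmaFinite (μ i)] {g : Fin n → α → ℝ≥0∞} (hg : ∀ i, Measurable (g i)) :
    ∫⁻ x, ∏ i, g i (x i) ∂Measure.pi μ = ∏ i, ∫⁻ x, g i x ∂μ i := by
  induction n with
  | zero => simp
  | succ n ih =>
    have hmp := (measurePreserving_piFinSuccAbove μ 0).symm
    rw [← hmp.lintegral_comp_emb (MeasurableEquiv.measurableEmbedding _)]
    simp_rw [MeasurableEquiv.piFinSuccAbove_symm_apply, Fin.insertNthEquiv, Fin.prod_univ_succ]
    simp only [Fin.zero_succAbove, Equiv.coe_fn_mk, Fin.insertNth_zero, Fin.cons_zero,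
      Fin.cons_succ, cast_eq]
    rw [lintegral_prod_mul (g := fun x : Fin n → α => ∏ i : Fin n, g i.succ (x i))
      (hg 0).aemeasurable (Finset.measurable_fun_prod _ fun i _ =>
        (hg i.succ).comp (measurable_pi_apply i)).aemeasurable,
      ih (fun i => μ i.succ) fun i => hg i.succ]

theorem pi_withDensity {α : Type*} [MeasurableSpace α] (n : ℕ) (ν : Measure α) [SigmaFinite ν]
    {g : α → ℝ≥0∞} (hg : Measurable g) [SigmaFinite (ν.withDensity g)] :
    Measure.pi (fun _ : Fin n => ν.withDensity g) =
      (Measure.pi fun _ : Fin n => ν).withDensity fun x => ∏ i, g (x i) := by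
  refine Measure.pi_eq fun s hs => ?_
  rw [withDensity_apply _ (MeasurableSet.univ_pi hs), ← lintegral_indicator
    (MeasurableSet.univ_pi hs)]
  have h : ∀ x : Fin n → α, (Set.univ.pi s).indicator (fun x => ∏ i, g (x i)) x
      = ∏ i, (s i).indicator g (x i) := fun x => by
    by_cases hx : x ∈ Set.univ.pi s
    · rw [Set.indicator_of_mem hx]
      exact Finset.prod_congr rfl fun i _ =>
        (Set.indicator_of_mem (hx i (Set.mem_univ i)) g).symm
    · rw [Set.indicator_of_notMem hx]
      obtain ⟨i, hi⟩ : ∃ i, x i ∉ s i := by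
        simpa [Set.mem_pi] using hx
      exact (Finset.prod_eq_zero (Finset.mem_univ i) (Set.indicator_of_notMem hi g)).symm
  simp_rw [h]
  rw [lintegral_fin_prod_eq_prod _ fun i => hg.indicator (hs i)]
  exact Finset.prod_congr rfl fun i _ => by
    rw [lintegral_indicator (hs i), withDensity_apply _ (hs i)]

/-- Integration of the first of `l + 1` independent variables. -/
theorem pi_apply_eq_lintegral_cons {α : Type*} [MeasurableSpace α] (l : ℕ) (ν : Measure α)
    [SigmaFinite ν] {B : Set (Fin (l + 1) → α)} (hB : MeasurableSet B) :
    Measure.pi (fun _ : Fin (l + 1) => ν) B =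
      ∫⁻ x, Measure.pi (fun _ : Fin l => ν) {y | (Fin.cons x y : Fin (l + 1) → α) ∈ B} ∂ν := by
  have hmp := (measurePreserving_piFinSuccAbove (fun _ : Fin (l + 1) => ν) 0).symm
  rw [← hmp.measure_preimage_equiv,
    Measure.prod_apply ((MeasurableEquiv.measurable _) hB)]
  simp only [MeasurableEquiv.piFinSuccAbove_symm_apply, Fin.insertNthEquiv, Equiv.coe_fn_mk,
    Fin.insertNth_zero]
  rfl

end ProductMeasures

/-! ### Small translations of a bounded density -/

section Translation

variable {d : ℕ}

/-- Translation is continuous in `L¹`. -/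
theorem tendsto_integral_abs_translate_sub {f : (Fin d → ℝ) → ℝ} (hf : Integrable f) :
    Tendsto (fun v : Fin d → ℝ => ∫ x, |f (x + v) - f x|) (𝓝 0) (𝓝 0) := by
  have hf1 : MemLp f 1 (volume : Measure (Fin d → ℝ)) := memLp_one_iff_integrable.2 hf
  have : Fact ((1 : ℝ≥0∞) ≠ ∞) := ⟨ENNReal.one_ne_top⟩
  have hc : Continuous fun v : Fin d → ℝ => (DomAddAct.mk v +ᵥ hf1.toLp f) := by
    have h1 : Continuous fun c : (Fin d → ℝ)ᵈᵃᵃ => (c +ᵥ hf1.toLp f) :=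
      continuous_id.vadd continuous_const
    exact h1.comp DomAddAct.continuous_mk
  have h2 : Tendsto (fun v : Fin d → ℝ => ‖(DomAddAct.mk v +ᵥ hf1.toLp f) - hf1.toLp f‖)
      (𝓝 0) (𝓝 0) := by
    have := ((hc.sub continuous_const).norm).tendsto (0 : Fin d → ℝ) (f := fun v : Fin d → ℝ =>
      ‖(DomAddAct.mk v +ᵥ hf1.toLp f) - hf1.toLp f‖)
    simpa using this
  refine h2.congr fun v => ?_
  rw [DomAddAct.mk_vadd_toLp, ← MemLp.toLp_sub, L1.norm_eq_integral_norm]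
  refine integral_congr_ae ?_
  filter_upwards [MemLp.coeFn_toLp
    ((hf1.comp_measurePreserving (measurePreserving_vadd v volume)).sub hf1)] with x hx
  refine (congrArg norm hx).trans ?_
  simp [add_comm]

theorem prod_le_pow_card_of_le {ι : Type*} (s : Finset ι) {a : ι → ℝ} {C : ℝ}
    (ha0 : ∀ i, 0 ≤ a i) (ha : ∀ i, a i ≤ C) : ∏ i ∈ s, a i ≤ C ^ s.card :=
  (Finset.prod_le_prod (fun i _ => ha0 i) fun i _ => ha i).trans_eq (Finset.prod_const C)

theorem abs_prod_sub_pow_le {ι : Type*} (s : Finset ι) {a : ι → ℝ} {b C : ℝ} (hC : 1 ≤ C)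
    (ha0 : ∀ i, 0 ≤ a i) (ha : ∀ i, a i ≤ C) (hb0 : 0 ≤ b) (hb : b ≤ C) :
    |∏ i ∈ s, a i - b ^ s.card| ≤ C ^ s.card * ∑ i ∈ s, |a i - b| := by
  classical
  induction s using Finset.induction_on with
  | empty => simp
  | insert i s hi ih =>
    rw [Finset.prod_insert hi, Finset.sum_insert hi, Finset.card_insert_of_notMem hi]
    have hp : |∏ j ∈ s, a j| ≤ C ^ s.card := by
      rw [abs_of_nonneg (Finset.prod_nonneg fun j _ => ha0 j)]
      exact prod_le_pow_card_of_le s ha0 ha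
    have hCs : C ^ s.card ≤ C ^ (s.card + 1) := pow_le_pow_right₀ hC (Nat.le_succ _)
    have e : a i * ∏ j ∈ s, a j - b ^ (s.card + 1)
        = (a i - b) * ∏ j ∈ s, a j + b * (∏ j ∈ s, a j - b ^ s.card) := by ring
    calc _ ≤ |a i - b| * C ^ s.card + C * (C ^ s.card * ∑ j ∈ s, |a j - b|) := by
          rw [e]
          refine (abs_add_le _ _).trans ?_
          rw [abs_mul, abs_mul, abs_of_nonneg hb0]
          exact add_le_add (mul_le_mul_of_nonneg_left hp (abs_nonneg _))
            (mul_le_mul hb ih (abs_nonneg _) (by linarith))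
      _ ≤ _ := by
          have := mul_le_mul_of_nonneg_left hCs (abs_nonneg (a i - b))
          rw [mul_add, pow_succ']
          rw [pow_succ'] at this
          nlinarith

/-- The product of a bounded density with `l` of its translates integrates, in the limit of small
translations, to the integral of the power `f ^ (l + 1)`. -/
theorem tendsto_integral_mul_prod_translate {f : (Fin d → ℝ) → ℝ} (hf : Integrable f)
    (hf0 : ∀ x, 0 ≤ f x) {C : ℝ} (hC : 1 ≤ C) (hfC : ∀ x, f x ≤ C) (hfm : Measurable f) {l : ℕ}
    (y : Fin l → (Fin d → ℝ)) :
    Tendsto (fun r : ℝ => ∫ x, f x * ∏ i, f (x + r • y i)) (𝓝 0) (𝓝 (∫ x, f x ^ (l + 1))) := by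
  have hint : ∀ r : ℝ, Integrable fun x => f x * ∏ i, f (x + r • y i) := fun r => by
    refine hf.mul_bdd (c := C ^ l) (Measurable.aestronglyMeasurable ?_)
      (Eventually.of_forall fun x => ?_)
    · exact Finset.measurable_fun_prod _ fun i _ => hfm.comp (measurable_id.add_const _)
    · rw [Real.norm_of_nonneg (Finset.prod_nonneg fun i _ => hf0 _)]
      simpa using prod_le_pow_card_of_le (Finset.univ : Finset (Fin l))
        (a := fun i => f (x + r • y i)) (fun i => hf0 _) fun i => hfC _
  have hint0 : Integrable fun x => f x ^ (l + 1) := by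
    simpa [pow_succ'] using hint 0
  have hdiff : ∀ r : ℝ, ∀ i, Integrable fun x => |f (x + r • y i) - f x| := fun r i =>
    ((hf.comp_add_right (r • y i)).sub hf).abs
  rw [tendsto_iff_norm_sub_tendsto_zero]
  refine squeeze_zero (g := fun r => C ^ (l + 1) * ∑ i, ∫ x, |f (x + r • y i) - f x|)
    (fun _ => norm_nonneg _) (fun r => ?_) ?_
  · rw [← integral_sub (hint r) hint0, ← integral_finsetSum _ fun i _ => hdiff r i,
      ← integral_const_mul]
    refine norm_integral_le_of_norm_le ((integrable_finsetSum _ fun i _ => hdiff r i).const_mul _)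
      (Eventually.of_forall fun x => ?_)
    have h := abs_prod_sub_pow_le (Finset.univ : Finset (Fin l)) (a := fun i => f (x + r • y i))
      hC (fun i => hf0 _) (fun i => hfC _) (hf0 x) (hfC x)
    rw [Finset.card_univ, Fintype.card_fin] at h
    rw [Real.norm_eq_abs, pow_succ', ← mul_sub, abs_mul, abs_of_nonneg (hf0 x), pow_succ',
      mul_assoc]
    exact mul_le_mul (hfC x) h (abs_nonneg _) (by linarith)
  · have : Tendsto (fun r : ℝ => C ^ (l + 1) * ∑ i, ∫ x, |f (x + r • y i) - f x|) (𝓝 0)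
        (𝓝 (C ^ (l + 1) * ∑ _i : Fin l, (0 : ℝ))) := by
      refine (tendsto_finsetSum _ fun i _ => ?_).const_mul _
      refine (tendsto_integral_abs_translate_sub hf).comp ?_
      have : Continuous fun r : ℝ => r • y i := by fun_prop
      simpa using this.tendsto 0
    simpa using this

end Translation

/-! ### Norms on `ℝ^d` and the volume of their balls -/

section Norm

variable {d : ℕ}

theorem continuous_seminorm (N : Seminorm ℝ (Fin d → ℝ)) : Continuous N := by
  have hb : ∀ x, N x ≤ (∑ i, N (Pi.single i 1)) * ‖x‖ := fun x => by
    have hx : x = ∑ i, x i • (Pi.single i (1 : ℝ) : Fin d → ℝ) := by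
      ext j
      simp [Finset.sum_apply, Pi.single_apply]
    calc N x = N (∑ i, x i • (Pi.single i (1 : ℝ) : Fin d → ℝ)) := by rw [← hx]
      _ ≤ ∑ i, N (x i • (Pi.single i (1 : ℝ) : Fin d → ℝ)) :=
        Finset.le_sum_of_subadditive N (map_zero N).le (map_add_le_add N) _ _
      _ ≤ ∑ i, N (Pi.single i 1) * ‖x‖ := Finset.sum_le_sum fun i _ => by
        rw [map_smul_eq_mul, mul_comm]
        exact mul_le_mul_of_nonneg_left (norm_le_pi_norm x i) (apply_nonneg N _)
      _ = _ := (Finset.sum_mul _ _ _).symm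
  have hc : (0 : ℝ) ≤ ∑ i, N (Pi.single i 1) := Finset.sum_nonneg fun i _ => apply_nonneg N _
  refine (LipschitzWith.of_dist_le_mul (K := ⟨_, hc⟩) fun x y => ?_).continuous
  rw [Real.dist_eq, dist_eq_norm]
  exact (abs_sub_map_le_sub N x y).trans (hb _)

/-- A norm on `ℝ^d` dominates a multiple of the maximum norm. -/
theorem exists_pos_mul_norm_le (N : Seminorm ℝ (Fin d → ℝ)) (hN : ∀ x, N x = 0 → x = 0) :
    ∃ c : ℝ, 0 < c ∧ ∀ x, c * ‖x‖ ≤ N x := by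
  rcases (Metric.sphere (0 : Fin d → ℝ) 1).eq_empty_or_nonempty with h | h
  · refine ⟨1, one_pos, fun x => ?_⟩
    have hx : x = 0 := by
      by_contra hx
      have : (‖x‖⁻¹ • x) ∈ Metric.sphere (0 : Fin d → ℝ) 1 := by
        simp [norm_smul, inv_mul_cancel₀ (norm_ne_zero_iff.2 hx)]
      simp [h] at this
    simp [hx]
  · obtain ⟨z, hz, hmin⟩ := (isCompact_sphere (0 : Fin d → ℝ) 1).exists_isMinOn h
      (continuous_seminorm N).continuousOn
    have hz0 : z ≠ 0 := by
      rintro rfl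
      simp at hz
    refine ⟨N z, lt_of_le_of_ne (apply_nonneg N z) fun h0 => hz0 (hN z h0.symm), fun x => ?_⟩
    rcases eq_or_ne x 0 with rfl | hx
    · simp
    have hx' : 0 < ‖x‖ := norm_pos_iff.2 hx
    have hmem : (‖x‖⁻¹ • x) ∈ Metric.sphere (0 : Fin d → ℝ) 1 := by
      simp [norm_smul, inv_mul_cancel₀ hx'.ne']
    have h1 : N z ≤ N (‖x‖⁻¹ • x) := hmin hmem
    rw [map_smul_eq_mul, norm_inv, norm_norm] at h1
    calc N z * ‖x‖ ≤ ‖x‖⁻¹ * N x * ‖x‖ := mul_le_mul_of_nonneg_right h1 hx'.le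
      _ = N x := by field_simp

theorem measurableSet_seminorm_sub_le (N : Seminorm ℝ (Fin d → ℝ)) (x₀ : Fin d → ℝ) (ρ : ℝ) :
    MeasurableSet {x | N (x - x₀) ≤ ρ} :=
  (isClosed_le ((continuous_seminorm N).comp (continuous_id.sub continuous_const))
    continuous_const).measurableSet

theorem volume_seminorm_le_lt_top (N : Seminorm ℝ (Fin d → ℝ)) (hN : ∀ x, N x = 0 → x = 0)
    (ρ : ℝ) : volume {x | N x ≤ ρ} < ∞ := by
  obtain ⟨c, hc, h⟩ := exists_pos_mul_norm_le N hN
  refine (measure_mono fun x hx => ?_).trans_lt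
    (measure_closedBall_lt_top (x := (0 : Fin d → ℝ)) (r := ρ / c))
  rw [mem_closedBall_zero_iff, le_div_iff₀ hc, mul_comm]
  exact (h x).trans hx

theorem volume_seminorm_le_pos (N : Seminorm ℝ (Fin d → ℝ)) {ρ : ℝ} (hρ : 0 < ρ) :
    0 < volume {x | N x ≤ ρ} := by
  have ho : IsOpen {x | N x < ρ} := isOpen_lt (continuous_seminorm N) continuous_const
  exact (ho.measure_pos volume ⟨0, by simpa using hρ⟩).trans_le 
    (measure_mono fun x (hx : N x < ρ) => show N x ≤ ρ from hx.le)

open scoped Pointwise in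
theorem volume_seminorm_sub_le (N : Seminorm ℝ (Fin d → ℝ)) (x₀ : Fin d → ℝ) {ρ : ℝ}
    (hρ : 0 < ρ) :
    volume {x | N (x - x₀) ≤ ρ} = ENNReal.ofReal (ρ ^ d) * volume {x | N x ≤ 1} := by
  have h1 : {x | N (x - x₀) ≤ ρ} = (fun x => x + (-x₀)) ⁻¹' {x | N x ≤ ρ} := by
    ext x; simp [sub_eq_add_neg]
  have h2 : {x | N x ≤ ρ} = ρ • {x | N x ≤ 1} := by
    ext x
    rw [Set.mem_smul_set_iff_inv_smul_mem₀ hρ.ne']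
    simp only [Set.mem_ofPred_eq, map_smul_eq_mul, norm_inv, Real.norm_of_nonneg hρ.le]
    rw [inv_mul_le_iff₀ hρ, mul_one]
  rw [h1, measure_preimage_add_right, h2, Measure.addHaar_smul]
  simp [abs_of_pos hρ]

end Norm

/-! ### The probability that `k + 1` points form a star -/

section Stars

variable {d : ℕ}

/-- Some point of the family `x` is within distance `r` of all the others. For a family of `k + 1`
distinct points this says that the geometric graph of radius `r` on them has a vertex of
degree `k`. -/
def HasCenter (N : Seminorm ℝ (Fin d → ℝ)) (r : ℝ) {ι : Type*} (x : ι → Fin d → ℝ) : Prop :=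
  ∃ i, ∀ j, N (x i - x j) ≤ r

/-- The `k`-tuples `y` for which `(0, y)` has a point within distance `1` of all the others. -/
def unitStars (N : Seminorm ℝ (Fin d → ℝ)) (k : ℕ) : Set (Fin k → Fin d → ℝ) :=
  {y | HasCenter N 1 (Fin.cons 0 y : Fin (k + 1) → Fin d → ℝ)}

theorem measurableSet_hasCenter (N : Seminorm ℝ (Fin d → ℝ)) (r : ℝ) {ι : Type*} [Countable ι] :
    MeasurableSet {x : ι → Fin d → ℝ | HasCenter N r x} := by
  have hN := (continuous_seminorm N).measurable
  simp only [HasCenter, Set.ofPred_exists, Set.ofPred_forall]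
  refine MeasurableSet.iUnion fun i => MeasurableSet.iInter fun j => ?_
  exact measurableSet_le (hN.comp ((measurable_pi_apply i).sub (measurable_pi_apply j)))
    measurable_const

theorem measurable_fin_cons {α : Type*} [MeasurableSpace α] (l : ℕ) (x : α) :
    Measurable fun y : Fin l → α => (Fin.cons x y : Fin (l + 1) → α) := by
  refine measurable_pi_iff.2 fun i => ?_
  refine Fin.cases ?_ (fun j => ?_) i
  · simp
  · simpa using measurable_pi_apply j

theorem measurableSet_unitStars (N : Seminorm ℝ (Fin d → ℝ)) (k : ℕ) :
    MeasurableSet (unitStars N k) :=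
  measurable_fin_cons k 0 (measurableSet_hasCenter N 1)

theorem hasCenter_affine_iff (N : Seminorm ℝ (Fin d → ℝ)) {r : ℝ} (hr : 0 < r) {ι : Type*}
    (x₀ : Fin d → ℝ) (z : ι → Fin d → ℝ) :
    HasCenter N r (fun i => x₀ + r • z i) ↔ HasCenter N 1 z := by
  refine exists_congr fun i => forall_congr' fun j => ?_
  rw [add_sub_add_left_eq_sub, ← smul_sub, map_smul_eq_mul, Real.norm_of_nonneg hr.le]
  exact mul_le_iff_le_one_right hr

theorem unitStars_subset (N : Seminorm ℝ (Fin d → ℝ)) (k : ℕ) :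
    unitStars N k ⊆ Set.univ.pi fun _ => {x | N x ≤ 2} := by
  rintro y ⟨i, hi⟩ j -
  have h0 := hi 0
  have hj := hi j.succ
  rw [Fin.cons_zero] at h0
  rw [Fin.cons_succ] at hj
  calc N (y j) = N (((Fin.cons 0 y : Fin (k + 1) → Fin d → ℝ) i - 0)
        - ((Fin.cons 0 y : Fin (k + 1) → Fin d → ℝ) i - y j)) := by congr 1; abel
    _ ≤ _ := map_sub_le_add N _ _
    _ ≤ 2 := by linarith

theorem subset_unitStars (N : Seminorm ℝ (Fin d → ℝ)) (k : ℕ) :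
    (Set.univ.pi fun _ => {x | N x ≤ 1}) ⊆ unitStars N k := by
  intro y hy
  refine ⟨0, fun j => ?_⟩
  refine Fin.cases ?_ (fun j => ?_) j
  · simp
  · simpa [map_neg_eq_map] using hy j (Set.mem_univ j)

theorem volume_unitStars_lt_top (N : Seminorm ℝ (Fin d → ℝ)) (hN : ∀ x, N x = 0 → x = 0)
    (k : ℕ) : volume (unitStars N k) < ∞ := by
  refine (measure_mono (unitStars_subset N k)).trans_lt ?_
  rw [volume_pi_pi]
  exact ENNReal.prod_lt_top fun i _ => volume_seminorm_le_lt_top N hN 2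

theorem volume_unitStars_pos (N : Seminorm ℝ (Fin d → ℝ)) (k : ℕ) :
    0 < volume (unitStars N k) := by
  refine lt_of_lt_of_le ?_ (measure_mono (subset_unitStars N k))
  rw [volume_pi_pi, pos_iff_ne_zero, Finset.prod_ne_zero_iff]
  exact fun i _ => (volume_seminorm_le_pos N one_pos).ne'

/-- The probability that `l` further independent points all fall within distance `ρ` of the first
one is of order `ρ ^ (d l)`. -/
theorem pi_near_first_le (N : Seminorm ℝ (Fin d → ℝ)) {f : (Fin d → ℝ) → ℝ} {C : ℝ}
    (hfC : ∀ x, f x ≤ C) {ν : Measure (Fin d → ℝ)} [IsProbabilityMeasure ν]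
    (hν : ν = volume.withDensity fun x => ENNReal.ofReal (f x)) (l : ℕ) {ρ : ℝ} (hρ : 0 < ρ) :
    Measure.pi (fun _ : Fin (l + 1) => ν) {x | ∀ j, N (x j - x 0) ≤ ρ} ≤
      (ENNReal.ofReal C * (ENNReal.ofReal (ρ ^ d) * volume {x | N x ≤ 1})) ^ l := by
  have hNm := (continuous_seminorm N).measurable
  have hB : MeasurableSet {x : Fin (l + 1) → Fin d → ℝ | ∀ j, N (x j - x 0) ≤ ρ} := by
    simp only [Set.ofPred_forall]
    exact MeasurableSet.iInter fun j => measurableSet_le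
      (hNm.comp ((measurable_pi_apply j).sub (measurable_pi_apply 0))) measurable_const
  have hball : ∀ x₀ : Fin d → ℝ, ν {x | N (x - x₀) ≤ ρ} ≤
      ENNReal.ofReal C * (ENNReal.ofReal (ρ ^ d) * volume {x | N x ≤ 1}) := fun x₀ => by
    rw [hν, withDensity_apply _ (measurableSet_seminorm_sub_le N x₀ ρ),
      ← volume_seminorm_sub_le N x₀ hρ]
    refine (setLIntegral_mono measurable_const
      (fun x _ => ENNReal.ofReal_le_ofReal (hfC x))).trans_eq ?_
    rw [setLIntegral_const]
  rw [pi_apply_eq_lintegral_cons l ν hB]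
  calc _ ≤ ∫⁻ _, (ENNReal.ofReal C * (ENNReal.ofReal (ρ ^ d) * volume {x | N x ≤ 1})) ^ l ∂ν := by
        refine lintegral_mono fun x₀ => ?_
        have hsub : {y : Fin l → Fin d → ℝ | (Fin.cons x₀ y : Fin (l + 1) → Fin d → ℝ) ∈
            {x : Fin (l + 1) → Fin d → ℝ | ∀ j, N (x j - x 0) ≤ ρ}} ⊆
            Set.univ.pi fun _ => {x | N (x - x₀) ≤ ρ} := by
          intro y hy j _
          simpa using hy j.succ
        refine (measure_mono hsub).trans ?_
        rw [Measure.pi_pi]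
        exact (Finset.prod_le_prod' fun i _ => hball x₀).trans_eq (by simp)
    _ = _ := by simp

/-- The substitution `x_i = x_0 + r y_i` in the probability that `k + 1` independent points have
a centre at distance `r`. -/
theorem pi_hasCenter_eq (N : Seminorm ℝ (Fin d → ℝ)) {f : (Fin d → ℝ) → ℝ} (hfm : Measurable f)
    {ν : Measure (Fin d → ℝ)} [IsProbabilityMeasure ν]
    (hν : ν = volume.withDensity fun x => ENNReal.ofReal (f x)) (k : ℕ) {r : ℝ} (hr : 0 < r) :
    Measure.pi (fun _ : Fin (k + 1) => ν) {x | HasCenter N r x} =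
      ENNReal.ofReal (r ^ (d * k)) * ∫⁻ y in unitStars N k,
        ∫⁻ x, ENNReal.ofReal (f x) * ∏ i, ENNReal.ofReal (f (x + r • y i)) := by
  set g : (Fin d → ℝ) → ℝ≥0∞ := fun x => ENNReal.ofReal (f x) with hg
  have hgm : Measurable g := hfm.ennreal_ofReal
  have hgp : Measurable fun z : Fin k → Fin d → ℝ => ∏ i, g (z i) :=
    Finset.measurable_fun_prod _ fun i _ => hgm.comp (measurable_pi_apply i)
  have hsf : SigmaFinite (volume.withDensity g) := hν ▸ inferInstance
  have hinner : ∀ x₀ : Fin d → ℝ, Measure.pi (fun _ : Fin k => ν)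
      {y | (Fin.cons x₀ y : Fin (k + 1) → Fin d → ℝ) ∈
        {x : Fin (k + 1) → Fin d → ℝ | HasCenter N r x}} =
      ENNReal.ofReal (r ^ (d * k)) * ∫⁻ y in unitStars N k, ∏ i, g (x₀ + r • y i) := by
    intro x₀
    set B : Set (Fin k → Fin d → ℝ) := {y | (Fin.cons x₀ y : Fin (k + 1) → Fin d → ℝ) ∈
        {x : Fin (k + 1) → Fin d → ℝ | HasCenter N r x}} with hB
    have hBm : MeasurableSet B := measurable_fin_cons k x₀ (measurableSet_hasCenter N r)
    have hφm : Measurable (B.indicator fun z => ∏ i, g (z i)) := hgp.indicator hBm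
    rw [hν, pi_withDensity k volume hgm, withDensity_apply _ hBm, ← lintegral_indicator hBm,
      ← volume_pi, ← lintegral_add_right_eq_self _ (fun _ : Fin k => x₀)]
    have hscale := Measure.map_addHaar_smul (volume : Measure (Fin k → Fin d → ℝ)) hr.ne'
    have hvol : (volume : Measure (Fin k → Fin d → ℝ)) =
        ENNReal.ofReal (r ^ (d * k)) • Measure.map (r • ·) volume := by
      rw [hscale, smul_smul, ← ENNReal.ofReal_mul (by positivity)]
      have : Module.finrank ℝ (Fin k → Fin d → ℝ) = d * k := by
        simp [Module.finrank_pi_fintype, mul_comm]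
      rw [this, abs_of_pos (by positivity), mul_inv_cancel₀ (by positivity)]
      simp
    have hshift : Measurable fun z : Fin k → Fin d → ℝ => z + fun _ => x₀ :=
      measurable_id.add_const _
    conv_lhs => rw [hvol]
    rw [lintegral_smul_measure,
      lintegral_map (f := fun z : Fin k → Fin d → ℝ =>
        B.indicator (fun a => ∏ i, g (a i)) (z + fun _ => x₀))
        (hφm.comp hshift) (measurable_const_smul r),
      ← lintegral_indicator (measurableSet_unitStars N k), smul_eq_mul]
    congr 1
    refine lintegral_congr fun y => ?_
    have hmem : (r • y + fun _ => x₀) ∈ B ↔ y ∈ unitStars N k := by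
      have hc : (Fin.cons x₀ (r • y + fun _ => x₀) : Fin (k + 1) → Fin d → ℝ) =
          fun i => x₀ + r • (Fin.cons 0 y : Fin (k + 1) → Fin d → ℝ) i := by
        funext i
        refine Fin.cases ?_ (fun j => ?_) i
        · simp
        · simp [add_comm]
      simp only [hB, Set.mem_ofPred_eq, hc, unitStars]
      exact hasCenter_affine_iff N hr x₀ _
    by_cases hy : y ∈ unitStars N k
    · rw [Set.indicator_of_mem (hmem.2 hy), Set.indicator_of_mem hy]
      simp [add_comm]
    · rw [Set.indicator_of_notMem (fun h => hy (hmem.1 h)), Set.indicator_of_notMem hy]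
  rw [pi_apply_eq_lintegral_cons k ν (measurableSet_hasCenter N r)]
  simp_rw [hinner]
  have hjoint : Measurable fun p : (Fin d → ℝ) × (Fin k → Fin d → ℝ) =>
      ∏ i, g (p.1 + r • p.2 i) :=
    Finset.measurable_fun_prod _ fun i _ => hgm.comp (by fun_prop)
  have hm1 : Measurable fun x₀ : Fin d → ℝ => ∫⁻ y in unitStars N k, ∏ i, g (x₀ + r • y i) :=
    hjoint.lintegral_prod_right'
  rw [lintegral_const_mul _ hm1]
  congr 1
  rw [hν, lintegral_withDensity_eq_lintegral_mul _ hgm hm1, lintegral_lintegral_swap]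
  · refine lintegral_congr fun x₀ => ?_
    rw [Pi.mul_apply, lintegral_const_mul]
    exact hjoint.comp measurable_prodMk_left
  · exact (((hgm.comp measurable_snd).mul (hjoint.comp measurable_swap))).aemeasurable

theorem lintegral_ofReal_pow_succ_lt_top {f : (Fin d → ℝ) → ℝ} (hfm : Measurable f) {C : ℝ}
    (hC : 1 ≤ C) (hfC : ∀ x, f x ≤ C) (hf1 : ∫⁻ x, ENNReal.ofReal (f x) = 1) (k : ℕ) :
    ∫⁻ x, ENNReal.ofReal (f x) ^ (k + 1) < ∞ := by
  refine lt_of_le_of_lt ?_ (ENNReal.ofReal_lt_top (r := C ^ k))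
  calc ∫⁻ x, ENNReal.ofReal (f x) ^ (k + 1)
      ≤ ∫⁻ x, ENNReal.ofReal (C ^ k) * ENNReal.ofReal (f x) := by
        refine lintegral_mono fun x => ?_
        rw [pow_succ, ENNReal.ofReal_pow (by linarith)]
        exact mul_le_mul_left (pow_le_pow_left₀ zero_le
          (ENNReal.ofReal_le_ofReal (hfC x)) k) _
    _ = ENNReal.ofReal (C ^ k) := by
        rw [lintegral_const_mul _ hfm.ennreal_ofReal, hf1, mul_one]

/-- The asymptotics of the probability that `k + 1` independent points have a centre at distance
`r`, as `r → 0`. -/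
theorem tendsto_pi_hasCenter_div (N : Seminorm ℝ (Fin d → ℝ)) (hN : ∀ x, N x = 0 → x = 0)
    {f : (Fin d → ℝ) → ℝ} (hfm : Measurable f) (hf0 : ∀ x, 0 ≤ f x) {C : ℝ} (hC : 1 ≤ C)
    (hfC : ∀ x, f x ≤ C) {ν : Measure (Fin d → ℝ)} [IsProbabilityMeasure ν]
    (hν : ν = volume.withDensity fun x => ENNReal.ofReal (f x)) (k : ℕ) :
    Tendsto (fun r : ℝ => (Measure.pi (fun _ : Fin (k + 1) => ν)).real {x | HasCenter N r x}
      / r ^ (d * k)) (𝓝[>] 0)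
      (𝓝 (((∫⁻ x, ENNReal.ofReal (f x) ^ (k + 1)) * volume (unitStars N k)).toReal)) := by
  have hf1 : ∫⁻ x, ENNReal.ofReal (f x) = 1 := by
    have := measure_univ (μ := ν)
    rwa [hν, withDensity_apply _ MeasurableSet.univ, setLIntegral_univ] at this
  have hf : Integrable f := by
    refine ⟨hfm.aestronglyMeasurable, ?_⟩
    rw [hasFiniteIntegral_iff_ofReal (Eventually.of_forall hf0), hf1]
    exact ENNReal.one_lt_top
  have hgm : Measurable fun x => ENNReal.ofReal (f x) := hfm.ennreal_ofReal
  have hjoint : ∀ r : ℝ, Measurable fun p : (Fin k → Fin d → ℝ) × (Fin d → ℝ) =>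
      ENNReal.ofReal (f p.2) * ∏ i, ENNReal.ofReal (f (p.2 + r • p.1 i)) := fun r =>
    (hgm.comp measurable_snd).mul
      (Finset.measurable_fun_prod _ fun i _ => hgm.comp (by fun_prop))
  have hprod : ∀ (r : ℝ) (y : Fin k → Fin d → ℝ) (x : Fin d → ℝ),
      ENNReal.ofReal (f x) * ∏ i, ENNReal.ofReal (f (x + r • y i)) =
        ENNReal.ofReal (f x * ∏ i, f (x + r • y i)) := fun r y x => by
    rw [ENNReal.ofReal_mul (hf0 x), ENNReal.ofReal_prod_of_nonneg fun i _ => hf0 _]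
  have hnn : ∀ (r : ℝ) (y : Fin k → Fin d → ℝ) (x : Fin d → ℝ),
      0 ≤ f x * ∏ i, f (x + r • y i) := fun r y x =>
    mul_nonneg (hf0 x) (Finset.prod_nonneg fun i _ => hf0 _)
  have hprodle : ∀ (r : ℝ) (y : Fin k → Fin d → ℝ) (x : Fin d → ℝ),
      ∏ i, f (x + r • y i) ≤ C ^ k := fun r y x => by
    simpa using prod_le_pow_card_of_le (Finset.univ : Finset (Fin k))
        (a := fun i => f (x + r • y i)) (fun i => hf0 _) fun i => hfC _
  have hint : ∀ (r : ℝ) (y : Fin k → Fin d → ℝ),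
      Integrable fun x => f x * ∏ i, f (x + r • y i) := fun r y => by
    refine hf.mul_bdd (c := C ^ k) (Measurable.aestronglyMeasurable ?_)
      (Eventually.of_forall fun x => ?_)
    · exact Finset.measurable_fun_prod _ fun i _ => hfm.comp (measurable_id.add_const _)
    · rw [Real.norm_of_nonneg (Finset.prod_nonneg fun i _ => hf0 _)]
      exact hprodle r y x
  have hlim : Tendsto (fun r : ℝ => ∫⁻ y in unitStars N k,
        ∫⁻ x, ENNReal.ofReal (f x) * ∏ i, ENNReal.ofReal (f (x + r • y i))) (𝓝[>] 0)
      (𝓝 (∫⁻ _ in unitStars N k, ∫⁻ x, ENNReal.ofReal (f x) ^ (k + 1))) := by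
    refine tendsto_lintegral_filter_of_dominated_convergence
      (fun _ => ENNReal.ofReal (C ^ k)) (Eventually.of_forall fun r => ?_)
      (Eventually.of_forall fun r => Eventually.of_forall fun y => ?_) ?_
      (Eventually.of_forall fun y => ?_)
    · exact (hjoint r).lintegral_prod_right'
    · simp_rw [hprod]
      calc ∫⁻ x, ENNReal.ofReal (f x * ∏ i, f (x + r • y i))
          ≤ ∫⁻ x, ENNReal.ofReal (C ^ k) * ENNReal.ofReal (f x) := by
            refine lintegral_mono fun x => ?_
            rw [← ENNReal.ofReal_mul (by positivity), mul_comm (C ^ k)]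
            exact ENNReal.ofReal_le_ofReal (mul_le_mul_of_nonneg_left (hprodle r y x) (hf0 x))
        _ = ENNReal.ofReal (C ^ k) := by rw [lintegral_const_mul _ hgm, hf1, mul_one]
    · rw [setLIntegral_const]
      exact ENNReal.mul_ne_top ENNReal.ofReal_ne_top (volume_unitStars_lt_top N hN k).ne
    · have h := (tendsto_integral_mul_prod_translate hf hf0 hC hfC hfm y).mono_left
        (nhdsWithin_le_nhds (s := Set.Ioi 0))
      have h2 := (ENNReal.continuous_ofReal.tendsto _).comp h
      have e : ENNReal.ofReal (∫ x, f x ^ (k + 1)) = ∫⁻ x, ENNReal.ofReal (f x) ^ (k + 1) := by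
        rw [ofReal_integral_eq_lintegral_ofReal]
        · simp_rw [ENNReal.ofReal_pow (hf0 _)]
        · simpa [pow_succ'] using hint 0 y
        · exact Eventually.of_forall fun x => pow_nonneg (hf0 x) _
      rw [e] at h2
      refine h2.congr fun r => ?_
      simp_rw [hprod]
      exact ofReal_integral_eq_lintegral_ofReal (hint r y) (Eventually.of_forall fun x => hnn r y x)
  rw [setLIntegral_const] at hlim
  have hfin : (∫⁻ x, ENNReal.ofReal (f x) ^ (k + 1)) * volume (unitStars N k) ≠ ∞ :=
    ENNReal.mul_ne_top (lintegral_ofReal_pow_succ_lt_top hfm hC hfC hf1 k).ne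
      (volume_unitStars_lt_top N hN k).ne
  refine ((ENNReal.tendsto_toReal hfin).comp hlim).congr' ?_
  filter_upwards [self_mem_nhdsWithin] with r hr
  have hr0 : (0 : ℝ) < r := hr
  rw [Function.comp_apply, measureReal_def, pi_hasCenter_eq N hfm hν k hr0, ENNReal.toReal_mul,
    ENNReal.toReal_ofReal (by positivity), mul_div_cancel_left₀ _ (by positivity)]

end Stars

/-! ### The total mass of the feasible graphs -/

section GraphMass

variable {d : ℕ}

/-- The geometric graph of radius `r` on a family of points, on the index set of the family. -/
def tupleGraph (N : Seminorm ℝ (Fin d → ℝ)) (r : ℝ) {ι : Type*} (x : ι → Fin d → ℝ) :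
    SimpleGraph ι where
  Adj i j := i ≠ j ∧ N (x i - x j) ≤ r
  symm := ⟨fun _ _ h => ⟨h.1.symm, by rw [map_sub_rev]; exact h.2⟩⟩
  loopless := ⟨fun _ h => h.1 rfl⟩

theorem exists_tupleGraph_isUniversal_iff (N : Seminorm ℝ (Fin d → ℝ)) {r : ℝ} (hr : 0 ≤ r)
    {ι : Type*} (x : ι → Fin d → ℝ) :
    (∃ i, (tupleGraph N r x).IsUniversal i) ↔ HasCenter N r x := by
  refine exists_congr fun i => ⟨fun h j => ?_, fun h j hij => ⟨hij, h j⟩⟩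
  rcases eq_or_ne i j with rfl | hij
  · simpa using hr
  · exact (h hij).2

theorem nonempty_tupleGraph_iso (N : Seminorm ℝ (Fin d → ℝ)) (r : ℝ) {ι : Type*}
    {x : ι → Fin d → ℝ} (hx : Function.Injective x) {s : Finset (Fin d → ℝ)}
    (hs : ∀ p, p ∈ s ↔ ∃ i, x i = p) : Nonempty (tupleGraph N r x ≃g geometricGraph N s r) := by
  let e : ι ≃ s := Equiv.ofBijective (fun i => ⟨x i, (hs _).2 ⟨i, rfl⟩⟩)
    ⟨fun i j h => hx (congrArg Subtype.val h), fun ⟨p, hp⟩ => by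
      obtain ⟨i, hi⟩ := (hs p).1 hp
      exact ⟨i, Subtype.ext hi⟩⟩
  exact ⟨⟨e, fun {i j} => and_congr e.injective.ne_iff Iff.rfl⟩⟩

theorem isUniversal_of_iso {V W : Type*} {G : SimpleGraph V} {H : SimpleGraph W} (e : G ≃g H)
    (h : ∃ v, G.IsUniversal v) : ∃ w, H.IsUniversal w := by
  obtain ⟨v, hv⟩ := h
  refine ⟨e v, fun w hw => ?_⟩
  have : G.Adj v (e.symm w) := hv fun h => hw (by rw [h]; simp)
  simpa using e.map_adj_iff.2 this

/-- The entries of `(0, y)` are distinct for almost every `y`, because two of them agree only on a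
proper subspace. -/
theorem ae_injective_cons_zero (hd : 1 ≤ d) (k : ℕ) :
    ∀ᵐ y : Fin k → Fin d → ℝ,
      Function.Injective (Fin.cons 0 y : Fin (k + 1) → Fin d → ℝ) := by
  let L : (Fin k → Fin d → ℝ) →ₗ[ℝ] (Fin (k + 1) → Fin d → ℝ) :=
    { toFun := fun y => Fin.cons 0 y
      map_add' := fun a b => by
        funext i
        refine Fin.cases ?_ (fun j => ?_) i <;> simp
      map_smul' := fun c a => by
        funext i
        refine Fin.cases ?_ (fun j => ?_) i <;> simp }
  have h : ∀ i j : Fin (k + 1), i ≠ j →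
      ∀ᵐ y : Fin k → Fin d → ℝ, (Fin.cons 0 y : Fin (k + 1) → Fin d → ℝ) i ≠
        (Fin.cons 0 y : Fin (k + 1) → Fin d → ℝ) j := by
    intro i j hij
    let T : (Fin k → Fin d → ℝ) →ₗ[ℝ] (Fin d → ℝ) :=
      (LinearMap.proj (R := ℝ) (φ := fun _ => Fin d → ℝ) i -
        LinearMap.proj (R := ℝ) (φ := fun _ => Fin d → ℝ) j) ∘ₗ L
    have hT : LinearMap.ker T ≠ ⊤ := by
      -- the entries of `(0, 1, …, k)`, read as constant vectors, are distinct
      intro htop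
      have hmem : (fun l : Fin k => fun _ : Fin d => ((l : ℕ) : ℝ) + 1) ∈ LinearMap.ker T :=
        htop ▸ Submodule.mem_top
      have hval : ∀ l : Fin (k + 1), (Fin.cons 0 (fun l : Fin k => fun _ : Fin d =>
          ((l : ℕ) : ℝ) + 1) : Fin (k + 1) → Fin d → ℝ) l = fun _ => ((l : ℕ) : ℝ) := by
        intro l
        refine Fin.cases ?_ (fun m => ?_) l
        · funext; simp
        · funext; simp
      have h0 : (fun _ : Fin d => ((i : ℕ) : ℝ)) - (fun _ => ((j : ℕ) : ℝ)) = 0 := by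
        rw [← hval i, ← hval j]
        exact hmem
      have h1 := congrFun h0 ⟨0, hd⟩
      simp only [Pi.sub_apply, Pi.zero_apply, sub_eq_zero, Nat.cast_inj] at h1
      exact hij (Fin.ext h1)
    have h0 := Measure.addHaar_submodule (volume : Measure (Fin k → Fin d → ℝ)) _ hT
    rw [ae_iff]
    refine measure_mono_null (fun y hy => ?_) h0
    have hy' : (Fin.cons 0 y : Fin (k + 1) → Fin d → ℝ) i =
        (Fin.cons 0 y : Fin (k + 1) → Fin d → ℝ) j := not_not.1 hy
    change (Fin.cons 0 y : Fin (k + 1) → Fin d → ℝ) i -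
        (Fin.cons 0 y : Fin (k + 1) → Fin d → ℝ) j = 0
    rw [hy', sub_self]
  filter_upwards [ae_all_iff.2 fun i => ae_all_iff.2 fun j =>
    ae_all_iff.2 fun hij => h i j hij] with y hy i j hij
  by_contra hne
  exact hy i j hne hij

theorem measurableSet_tupleGraph_mem (N : Seminorm ℝ (Fin d → ℝ)) (r : ℝ) (n : ℕ)
    (𝒢 : Set (SimpleGraph (Fin n))) :
    MeasurableSet {x : Fin n → Fin d → ℝ | tupleGraph N r x ∈ 𝒢} := by
  have hNm := (continuous_seminorm N).measurable
  have h1 : ∀ G : SimpleGraph (Fin n),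
      MeasurableSet {x : Fin n → Fin d → ℝ | tupleGraph N r x = G} := by
    intro G
    have : {x : Fin n → Fin d → ℝ | tupleGraph N r x = G} =
        ⋂ i, ⋂ j, {x | (i ≠ j ∧ N (x i - x j) ≤ r) ↔ G.Adj i j} := by
      ext x
      simp only [Set.mem_iInter, Set.mem_ofPred_eq, SimpleGraph.ext_iff, funext_iff, eq_iff_iff]
      rfl
    rw [this]
    refine MeasurableSet.iInter fun i => MeasurableSet.iInter fun j => ?_
    have hm : MeasurableSet {x : Fin n → Fin d → ℝ | i ≠ j ∧ N (x i - x j) ≤ r} :=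
      (MeasurableSet.const _).inter (measurableSet_le
        (hNm.comp ((measurable_pi_apply i).sub (measurable_pi_apply j))) measurable_const)
    by_cases hG : G.Adj i j
    · simpa only [hG, iff_true] using hm
    · simp only [hG, iff_false]
      exact hm.compl
  have h2 : {x : Fin n → Fin d → ℝ | tupleGraph N r x ∈ 𝒢} =
      ⋃ G ∈ 𝒢, {x | tupleGraph N r x = G} := by
    ext x; simp
  rw [h2]
  exact MeasurableSet.biUnion (Set.to_countable 𝒢) fun G _ => h1 G

open Classical in
theorem isoIndicator_insert_zero_image (N : Seminorm ℝ (Fin d → ℝ)) {k : ℕ}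
    {y : Fin k → Fin d → ℝ}
    (hy : Function.Injective (Fin.cons 0 y : Fin (k + 1) → Fin d → ℝ))
    (Γ : SimpleGraph (Fin (k + 1))) :
    isoIndicator N Γ (insert 0 (Finset.univ.image y)) =
      if Nonempty (tupleGraph N 1 (Fin.cons 0 y : Fin (k + 1) → Fin d → ℝ) ≃g Γ)
        then 1 else 0 := by
  obtain ⟨e⟩ := nonempty_tupleGraph_iso N 1 hy (s := insert 0 (Finset.univ.image y)) fun p => by
    simp [Fin.exists_fin_succ, eq_comm]
  exact if_congr ⟨fun ⟨a⟩ => ⟨e.trans a⟩, fun ⟨a⟩ => ⟨e.symm.trans a⟩⟩ rfl rfl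

open Classical in
/-- Each configuration with a centre is isomorphic to exactly one of the listed representatives,
and the others to none of them: the masses `μ_Γ` add up to the volume of all configurations with a
centre. Infeasible graphs may be added to the sum, as they contribute `0`. -/
theorem totalMass_eq (hd : 1 ≤ d) (N : Seminorm ℝ (Fin d → ℝ)) (f : (Fin d → ℝ) → ℝ) (k : ℕ) :
    totalMass N f k = ((k + 1).factorial : ℝ≥0∞)⁻¹ *
      ((∫⁻ x, ENNReal.ofReal (f x) ^ (k + 1)) * volume (unitStars N k)) := by
  set reps : Finset (SimpleGraph (Fin (k + 1))) :=
    (Finset.univ.image fun c : Quotient (isoSetoid (k + 1)) => c.out).filter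
      fun Γ => ∃ v, Γ.IsUniversal v with hreps
  have hdeg : ∀ Γ : SimpleGraph (Fin (k + 1)), (∃ v, Γ.degree v = k) ↔ ∃ v, Γ.IsUniversal v :=
    fun Γ => exists_congr fun v => by
      rw [← SimpleGraph.degree_eq_card_sub_one, Fintype.card_fin, Nat.add_sub_cancel]
  have h1 : totalMass N f k = ∑ Γ ∈ reps, graphMass N f Γ := by
    rw [totalMass]
    refine Finset.sum_subset (fun Γ hΓ => ?_) fun Γ hΓ hΓ' => ?_
    · rw [feasibleGraphs, Finset.mem_filter] at hΓ
      exact Finset.mem_filter.2 ⟨hΓ.1, (hdeg Γ).1 hΓ.2.2⟩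
    · rw [hreps, Finset.mem_filter] at hΓ
      by_contra hne
      refine hΓ' ?_
      rw [feasibleGraphs, Finset.mem_filter]
      exact ⟨hΓ.1, hne, (hdeg Γ).2 hΓ.2⟩
  have hind : ∀ Γ : SimpleGraph (Fin (k + 1)), AEMeasurable (fun y : Fin k → Fin d → ℝ =>
      isoIndicator N Γ (insert 0 (Finset.univ.image y))) := by
    intro Γ
    have hm : MeasurableSet {y : Fin k → Fin d → ℝ |
        Nonempty (tupleGraph N 1 (Fin.cons 0 y : Fin (k + 1) → Fin d → ℝ) ≃g Γ)} :=
      measurable_fin_cons k 0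
        (measurableSet_tupleGraph_mem N 1 (k + 1) {G | Nonempty (G ≃g Γ)})
    refine ⟨fun y => if Nonempty (tupleGraph N 1 (Fin.cons 0 y : Fin (k + 1) → Fin d → ℝ) ≃g Γ)
      then 1 else 0, Measurable.ite hm measurable_const measurable_const, ?_⟩
    filter_upwards [ae_injective_cons_zero hd k] with y hy
    exact isoIndicator_insert_zero_image N hy Γ
  have hsum : ∀ᵐ y : Fin k → Fin d → ℝ,
      ∑ Γ ∈ reps, isoIndicator N Γ (insert 0 (Finset.univ.image y)) =
        (unitStars N k).indicator 1 y := by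
    filter_upwards [ae_injective_cons_zero hd k] with y hy
    simp_rw [isoIndicator_insert_zero_image N hy]
    set H := tupleGraph N 1 (Fin.cons 0 y : Fin (k + 1) → Fin d → ℝ) with hH
    have hc : (∃ v, H.IsUniversal v) ↔ y ∈ unitStars N k :=
      exists_tupleGraph_isUniversal_iff N zero_le_one _
    by_cases hyS : y ∈ unitStars N k
    · rw [Set.indicator_of_mem hyS, Pi.one_apply]
      set c : Quotient (isoSetoid (k + 1)) := Quotient.mk _ H with hcdef
      obtain ⟨e⟩ : Nonempty (c.out ≃g H) := Quotient.exact (s := isoSetoid (k + 1)) (by simp [hcdef])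
      have hmem : c.out ∈ reps := Finset.mem_filter.2
        ⟨Finset.mem_image.2 ⟨c, Finset.mem_univ _, rfl⟩,
          isUniversal_of_iso e.symm (hc.2 hyS)⟩
      rw [Finset.sum_eq_single_of_mem _ hmem, if_pos ⟨e.symm⟩]
      intro Γ hΓ hne
      refine if_neg fun ⟨e'⟩ => hne ?_
      obtain ⟨c', -, rfl⟩ := Finset.mem_image.1 (Finset.mem_filter.1 hΓ).1
      congr 1
      rw [hcdef, ← Quotient.out_eq c']
      exact (Quotient.sound (s := isoSetoid (k + 1)) ⟨e'⟩).symm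
    · rw [Set.indicator_of_notMem hyS]
      refine Finset.sum_eq_zero fun Γ hΓ => if_neg fun ⟨e⟩ => hyS (hc.1 ?_)
      exact isUniversal_of_iso e.symm (Finset.mem_filter.1 hΓ).2
  rw [h1]
  simp only [graphMass]
  rw [← Finset.mul_sum, ← lintegral_finsetSum' _ fun Γ _ => hind Γ, lintegral_congr_ae hsum,
    lintegral_indicator_one (measurableSet_unitStars N k), mul_assoc]

theorem totalMass_pos (hd : 1 ≤ d) (N : Seminorm ℝ (Fin d → ℝ)) {f : (Fin d → ℝ) → ℝ}
    (hfm : Measurable f) (hf1 : ∫⁻ x, ENNReal.ofReal (f x) = 1) (k : ℕ) :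
    0 < totalMass N f k := by
  rw [totalMass_eq hd, pos_iff_ne_zero]
  refine mul_ne_zero (ENNReal.inv_ne_zero.2 (ENNReal.natCast_ne_top _))
    (mul_ne_zero (fun h => ?_) (volume_unitStars_pos N k).ne')
  rw [lintegral_eq_zero_iff (hfm.ennreal_ofReal.pow_const _)] at h
  have : ∫⁻ x, ENNReal.ofReal (f x) = 0 := by
    rw [lintegral_eq_zero_iff hfm.ennreal_ofReal]
    filter_upwards [h] with x hx
    exact eq_zero_of_pow_eq_zero hx
  rw [hf1] at this
  exact one_ne_zero this

theorem totalMass_lt_top (hd : 1 ≤ d) (N : Seminorm ℝ (Fin d → ℝ)) (hN : ∀ x, N x = 0 → x = 0)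
    {f : (Fin d → ℝ) → ℝ} (hfm : Measurable f) {C : ℝ} (hC : 1 ≤ C) (hfC : ∀ x, f x ≤ C)
    (hf1 : ∫⁻ x, ENNReal.ofReal (f x) = 1) (k : ℕ) : totalMass N f k < ∞ := by
  rw [totalMass_eq hd]
  exact ENNReal.mul_lt_top
    (ENNReal.inv_lt_top.2 (by exact_mod_cast Nat.factorial_pos _))
    (ENNReal.mul_lt_top (lintegral_ofReal_pow_succ_lt_top hfm hC hfC hf1 k)
      (volume_unitStars_lt_top N hN k))

end GraphMass

/-! ### Counting intersecting pairs of index sets -/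

section Counting

open Classical in
/-- Pairs of subsets of `{0, …, n - 1}` are counted by the size `m` of their union: there are at
most `n ^ m` unions of size `m`, and at most `4 ^ m` pairs with a given union. -/
theorem sum_sum_card_union_le (n : ℕ) (S : Finset (Finset ℕ)) (hS : ∀ α ∈ S, α ⊆ Finset.range n)
    (T : Finset ℕ → Finset (Finset ℕ)) (hT : ∀ α ∈ S, T α ⊆ S) (M : Finset ℕ)
    (hM : ∀ α ∈ S, ∀ β ∈ T α, (α ∪ β).card ∈ M) (F : ℕ → ℝ) (hF : ∀ m, 0 ≤ F m) :
    ∑ α ∈ S, ∑ β ∈ T α, F (α ∪ β).card ≤ ∑ m ∈ M, (n : ℝ) ^ m * 4 ^ m * F m := by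
  have hcard : ∀ m, (((S ×ˢ S).filter fun p => (p.1 ∪ p.2).card = m).card : ℝ) ≤
      (n : ℝ) ^ m * 4 ^ m := by
    intro m
    have hsub : ((S ×ˢ S).filter fun p => (p.1 ∪ p.2).card = m) ⊆
        (Finset.powersetCard m (Finset.range n)).biUnion fun U => U.powerset ×ˢ U.powerset := by
      rintro ⟨α, β⟩ h
      simp only [Finset.mem_filter, Finset.mem_product] at h
      simp only [Finset.mem_biUnion, Finset.mem_powersetCard, Finset.mem_product,
        Finset.mem_powerset]
      exact ⟨α ∪ β, ⟨Finset.union_subset (hS α h.1.1) (hS β h.1.2), h.2⟩,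
        Finset.subset_union_left, Finset.subset_union_right⟩
    have h1 := (Finset.card_le_card hsub).trans Finset.card_biUnion_le
    have h2 : ∑ U ∈ Finset.powersetCard m (Finset.range n), (U.powerset ×ˢ U.powerset).card =
        n.choose m * 4 ^ m := by
      rw [Finset.sum_congr rfl (g := fun _ => 4 ^ m), Finset.sum_const, Finset.card_powersetCard,
        Finset.card_range, smul_eq_mul]
      intro U hU
      rw [Finset.card_product, Finset.card_powerset, (Finset.mem_powersetCard.1 hU).2, ← mul_pow]
      norm_num
    rw [h2] at h1
    calc (((S ×ˢ S).filter fun p => (p.1 ∪ p.2).card = m).card : ℝ)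
        ≤ ((n.choose m * 4 ^ m : ℕ) : ℝ) := by exact_mod_cast h1
      _ ≤ ((n ^ m * 4 ^ m : ℕ) : ℝ) := by
          exact_mod_cast Nat.mul_le_mul_right _ (Nat.choose_le_pow n m)
      _ = _ := by push_cast; ring
  calc ∑ α ∈ S, ∑ β ∈ T α, F (α ∪ β).card
      ≤ ∑ α ∈ S, ∑ β ∈ S, ∑ m ∈ M, if (α ∪ β).card = m then F m else 0 := by
        refine Finset.sum_le_sum fun α hα => ?_
        calc ∑ β ∈ T α, F (α ∪ β).card
            = ∑ β ∈ T α, ∑ m ∈ M, if (α ∪ β).card = m then F m else 0 :=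
              Finset.sum_congr rfl fun β hβ => by
                rw [Finset.sum_ite_eq, if_pos (hM α hα β hβ)]
          _ ≤ _ := Finset.sum_le_sum_of_subset_of_nonneg (hT α hα) fun β _ _ =>
              Finset.sum_nonneg fun m _ => by split_ifs <;> simp [hF m]
    _ = ∑ m ∈ M, (((S ×ˢ S).filter fun p => (p.1 ∪ p.2).card = m).card : ℝ) * F m := by
        rw [← Finset.sum_product', Finset.sum_comm]
        refine Finset.sum_congr rfl fun m _ => ?_
        rw [← Finset.sum_filter, Finset.sum_const, nsmul_eq_mul]
    _ ≤ _ := Finset.sum_le_sum fun m _ => mul_le_mul_of_nonneg_right (hcard m) (hF m)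

end Counting

/-! ### The number of stars among `n` points -/

section StarEvents

variable {d : ℕ} {Ω : Type*}

/-- The event that one of the points `X i`, `i ∈ α`, is within distance `r` of all of them. -/
def starEvent (N : Seminorm ℝ (Fin d → ℝ)) (X : ℕ → Ω → Fin d → ℝ) (r : ℝ) (α : Finset ℕ) :
    Set Ω :=
  {ω | ∃ i ∈ α, ∀ j ∈ α, N (X i ω - X j ω) ≤ r}

variable [MeasurableSpace Ω]

theorem measurableSet_starEvent (N : Seminorm ℝ (Fin d → ℝ)) {X : ℕ → Ω → Fin d → ℝ}
    {α : Finset ℕ} (hX : ∀ i ∈ α, Measurable (X i)) (r : ℝ) :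
    MeasurableSet (starEvent N X r α) := by
  have hNm := (continuous_seminorm N).measurable
  have : starEvent N X r α = ⋃ i ∈ α, ⋂ j ∈ α, {ω | N (X i ω - X j ω) ≤ r} := by
    ext ω; simp [starEvent]
  rw [this]
  exact Finset.measurableSet_biUnion _ fun i hi => Finset.measurableSet_biInter _ fun j hj =>
    measurableSet_le (hNm.comp ((hX i hi).sub (hX j hj))) measurable_const

variable {P : Measure Ω} {X : ℕ → Ω → Fin d → ℝ} {ν : Measure (Fin d → ℝ)}

open Classical in
/-- The event of a star on `α` is determined by the points with index in `α`, and the number of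
stars on sets disjoint from `α` by the remaining points. -/
theorem indepFun_starEvent_eventCount (N : Seminorm ℝ (Fin d → ℝ)) (hXm : ∀ i, Measurable (X i))
    (hXi : iIndepFun X P) (r : ℝ) {n : ℕ} {S : Finset (Finset ℕ)}
    (hS : ∀ β ∈ S, β ⊆ Finset.range n) (α : Finset ℕ) :
    IndepFun ((starEvent N X r α).indicator (1 : Ω → ℕ))
      (eventCount (S.filter fun β => ¬ ¬ Disjoint α β) (starEvent N X r)) P := by
  have hlocal : ∀ T β : Finset ℕ, β ⊆ T → ∀ ω, ω ∈ starEvent N X r β ↔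
      (fun i : T => X i ω) ∈ {x : T → Fin d → ℝ |
        ∃ i : T, (i : ℕ) ∈ β ∧ ∀ j : T, (j : ℕ) ∈ β → N (x i - x j) ≤ r} := by
    intro T β hβ ω
    constructor
    · rintro ⟨i, hi, h⟩
      exact ⟨⟨i, hβ hi⟩, hi, fun j hj => h j hj⟩
    · rintro ⟨i, hi, h⟩
      exact ⟨i, hi, fun j hj => h ⟨j, hβ hj⟩ hj⟩
  have hmeas : ∀ T β : Finset ℕ, MeasurableSet {x : T → Fin d → ℝ |
        ∃ i : T, (i : ℕ) ∈ β ∧ ∀ j : T, (j : ℕ) ∈ β → N (x i - x j) ≤ r} := by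
    intro T β
    simp only [Set.ofPred_exists, Set.ofPred_and, Set.ofPred_forall]
    exact MeasurableSet.iUnion fun i => (MeasurableSet.const _).inter
      (MeasurableSet.iInter fun j => MeasurableSet.iInter fun _ => measurableSet_le
        ((continuous_seminorm N).measurable.comp
          ((measurable_pi_apply i).sub (measurable_pi_apply j))) measurable_const)
  have hind := hXi.indepFun_finset α (Finset.range n \ α) Finset.disjoint_sdiff hXm
  have h1 : (starEvent N X r α).indicator (1 : Ω → ℕ) =
      ({x : α → Fin d → ℝ | ∃ i : α, (i : ℕ) ∈ α ∧ ∀ j : α, (j : ℕ) ∈ α →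
        N (x i - x j) ≤ r}.indicator (1 : (α → Fin d → ℝ) → ℕ)) ∘ fun ω (i : α) => X i ω := by
    funext ω
    by_cases h : ω ∈ starEvent N X r α
    · rw [Set.indicator_of_mem h, Function.comp_apply,
        Set.indicator_of_mem ((hlocal α α subset_rfl ω).1 h)]
      rfl
    · rw [Set.indicator_of_notMem h, Function.comp_apply,
        Set.indicator_of_notMem fun h' => h ((hlocal α α subset_rfl ω).2 h')]
  have h2 : eventCount (S.filter fun β => ¬ ¬ Disjoint α β) (starEvent N X r) =
      (eventCount (S.filter fun β => ¬ ¬ Disjoint α β) fun β =>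
        {x : (Finset.range n \ α : Finset ℕ) → Fin d → ℝ |
          ∃ i : (Finset.range n \ α : Finset ℕ), (i : ℕ) ∈ β ∧
            ∀ j : (Finset.range n \ α : Finset ℕ), (j : ℕ) ∈ β → N (x i - x j) ≤ r}) ∘
        fun ω (i : (Finset.range n \ α : Finset ℕ)) => X i ω := by
    funext ω
    rw [Function.comp_apply, eventCount, eventCount]
    refine Finset.sum_congr rfl fun β hβ => ?_
    rw [Finset.mem_filter, not_not] at hβ
    have hsub : β ⊆ Finset.range n \ α := Finset.subset_sdiff.2 ⟨hS β hβ.1, hβ.2.symm⟩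
    by_cases h : ω ∈ starEvent N X r β
    · rw [Set.indicator_of_mem h, Set.indicator_of_mem ((hlocal _ β hsub ω).1 h)]
      rfl
    · rw [Set.indicator_of_notMem h,
        Set.indicator_of_notMem fun h' => h ((hlocal _ β hsub ω).2 h')]
  rw [h1, h2]
  exact hind.comp (measurable_one.indicator (hmeas _ _))
    (measurable_eventCount fun β _ => hmeas _ β)

variable [IsProbabilityMeasure P]

theorem map_tuple_eq_pi (hXm : ∀ i, Measurable (X i)) (hXi : iIndepFun X P)
    (hXl : ∀ i, P.map (X i) = ν) {n : ℕ} {e : Fin n → ℕ} (he : Function.Injective e) :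
    P.map (fun ω i => X (e i) ω) = Measure.pi fun _ : Fin n => ν := by
  have h := (iIndepFun_iff_map_fun_eq_pi_map (μ := P) (f := fun i => X (e i))
    fun i => (hXm _).aemeasurable).1 (hXi.precomp he)
  rw [h]
  simp_rw [hXl]

theorem measureReal_starEvent (N : Seminorm ℝ (Fin d → ℝ)) (hXm : ∀ i, Measurable (X i))
    (hXi : iIndepFun X P) (hXl : ∀ i, P.map (X i) = ν) (r : ℝ) {k : ℕ} {α : Finset ℕ}
    (hα : α.card = k + 1) :
    P.real (starEvent N X r α) =
      (Measure.pi fun _ : Fin (k + 1) => ν).real {x | HasCenter N r x} := by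
  have he : Function.Injective (α.orderEmbOfFin hα) := (α.orderEmbOfFin hα).injective
  rw [← map_tuple_eq_pi hXm hXi hXl he, map_measureReal_apply
    (measurable_pi_lambda _ fun i => hXm _) (measurableSet_hasCenter N r)]
  congr 1
  ext ω
  have hr : ∀ i, i ∈ α ↔ ∃ j, α.orderEmbOfFin hα j = i := fun i => by
    rw [← Set.mem_range, Finset.range_orderEmbOfFin, Finset.mem_coe]
  simp [starEvent, HasCenter, hr]

/-- Two star events with a common point force all points involved to be within `2 r` of it. -/
theorem measureReal_starEvent_inter_le (N : Seminorm ℝ (Fin d → ℝ))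
    (hN : ∀ x, N x = 0 → x = 0) {f : (Fin d → ℝ) → ℝ} {C : ℝ} (hC : 0 ≤ C)
    (hfC : ∀ x, f x ≤ C) [IsProbabilityMeasure ν]
    (hν : ν = volume.withDensity fun x => ENNReal.ofReal (f x))
    (hXm : ∀ i, Measurable (X i)) (hXi : iIndepFun X P) (hXl : ∀ i, P.map (X i) = ν) {r : ℝ}
    (hr : 0 < r) {α β : Finset ℕ} (hαβ : ¬ Disjoint α β) :
    P.real (starEvent N X r α ∩ starEvent N X r β) ≤
      (C * 2 ^ d * (volume {x | N x ≤ 1}).toReal * r ^ d) ^ ((α ∪ β).card - 1) := by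
  obtain ⟨i₀, hiα, hiβ⟩ := Finset.not_disjoint_iff.1 hαβ
  have hmem : i₀ ∈ α ∪ β := Finset.mem_union_left _ hiα
  have hl : ((α ∪ β).erase i₀).card = (α ∪ β).card - 1 := Finset.card_erase_of_mem hmem
  set l := (α ∪ β).card - 1 with hldef
  set e : Fin (l + 1) → ℕ := Fin.cons i₀ (((α ∪ β).erase i₀).orderEmbOfFin hl) with he
  have hei : Function.Injective e := by
    rw [he, Fin.cons_injective_iff]
    refine ⟨fun h => ?_, (((α ∪ β).erase i₀).orderEmbOfFin hl).injective⟩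
    rw [Finset.range_orderEmbOfFin] at h
    simp at h
  have hemem : ∀ j, e j ∈ α ∪ β := by
    intro j
    refine Fin.cases ?_ (fun j => ?_) j
    · exact hmem
    · exact Finset.mem_of_mem_erase (Finset.orderEmbOfFin_mem _ hl j)
  have hnear : ∀ γ : Finset ℕ, i₀ ∈ γ → ∀ ω ∈ starEvent N X r γ, ∀ j ∈ γ,
      N (X j ω - X i₀ ω) ≤ 2 * r := by
    rintro γ hγ ω ⟨i, -, hi⟩ j hj
    calc N (X j ω - X i₀ ω) = N ((X i ω - X i₀ ω) - (X i ω - X j ω)) := by congr 1; abel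
      _ ≤ _ := map_sub_le_add N _ _
      _ ≤ 2 * r := by linarith [hi j hj, hi i₀ hγ]
  have hsub : starEvent N X r α ∩ starEvent N X r β ⊆
      (fun ω i => X (e i) ω) ⁻¹' {x : Fin (l + 1) → Fin d → ℝ | ∀ j, N (x j - x 0) ≤ 2 * r} := by
    rintro ω ⟨h1, h2⟩ j
    rcases Finset.mem_union.1 (hemem j) with h | h
    · exact hnear α hiα ω h1 _ h
    · exact hnear β hiβ ω h2 _ h
  have hBm : MeasurableSet {x : Fin (l + 1) → Fin d → ℝ | ∀ j, N (x j - x 0) ≤ 2 * r} := by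
    simp only [Set.ofPred_forall]
    exact MeasurableSet.iInter fun j => measurableSet_le
      ((continuous_seminorm N).measurable.comp
        ((measurable_pi_apply j).sub (measurable_pi_apply 0))) measurable_const
  have hle : P (starEvent N X r α ∩ starEvent N X r β) ≤
      (ENNReal.ofReal C * (ENNReal.ofReal ((2 * r) ^ d) * volume {x | N x ≤ 1})) ^ l := by
    refine (measure_mono hsub).trans ?_
    rw [← Measure.map_apply (measurable_pi_lambda _ fun i => hXm _) hBm,
      map_tuple_eq_pi hXm hXi hXl hei]
    exact pi_near_first_le N hfC hν l (by positivity)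
  have hfin : (ENNReal.ofReal C * (ENNReal.ofReal ((2 * r) ^ d) * volume {x | N x ≤ 1})) ^ l ≠ ∞ :=
    ENNReal.pow_ne_top (ENNReal.mul_ne_top ENNReal.ofReal_ne_top
      (ENNReal.mul_ne_top ENNReal.ofReal_ne_top (volume_seminorm_le_lt_top N hN 1).ne))
  refine (ENNReal.toReal_mono hfin hle).trans_eq ?_
  rw [ENNReal.toReal_pow, ENNReal.toReal_mul, ENNReal.toReal_mul, ENNReal.toReal_ofReal hC,
    ENNReal.toReal_ofReal (by positivity)]
  ring

open Classical in
/-- The Poisson approximation for the number of stars of radius `r` among `n` points. -/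
theorem abs_measureReal_no_star_sub_exp_le (N : Seminorm ℝ (Fin d → ℝ))
    (hN : ∀ x, N x = 0 → x = 0) {f : (Fin d → ℝ) → ℝ} {C : ℝ} (hC : 0 ≤ C)
    (hfC : ∀ x, f x ≤ C) [IsProbabilityMeasure ν]
    (hν : ν = volume.withDensity fun x => ENNReal.ofReal (f x))
    (hXm : ∀ i, Measurable (X i)) (hXi : iIndepFun X P) (hXl : ∀ i, P.map (X i) = ν) {r : ℝ}
    (hr : 0 < r) (k n : ℕ) {p : ℝ}
    (hp : p = (Measure.pi fun _ : Fin (k + 1) => ν).real {x | HasCenter N r x}) :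
    |P.real {ω | ∀ α ∈ Finset.powersetCard (k + 1) (Finset.range n), ω ∉ starEvent N X r α} -
        Real.exp (-(n.choose (k + 1) * p))| ≤
      (∑ m ∈ Finset.range (2 * k + 2), (n : ℝ) ^ m * 4 ^ m * p ^ 2) +
        ∑ m ∈ Finset.Ico (k + 2) (2 * k + 2), (n : ℝ) ^ m * 4 ^ m *
          (C * 2 ^ d * (volume {x | N x ≤ 1}).toReal * r ^ d) ^ (m - 1) := by
  set S := Finset.powersetCard (k + 1) (Finset.range n) with hS
  have hSsub : ∀ α ∈ S, α ⊆ Finset.range n := fun α hα => (Finset.mem_powersetCard.1 hα).1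
  have hScard : ∀ α ∈ S, α.card = k + 1 := fun α hα => (Finset.mem_powersetCard.1 hα).2
  have hprob : ∀ α ∈ S, P.real (starEvent N X r α) = p := fun α hα => by
    rw [hp]; exact measureReal_starEvent N hXm hXi hXl r (hScard α hα)
  have hunion : ∀ α ∈ S, ∀ β ∈ S, ¬ Disjoint α β → (α ∪ β).card < 2 * k + 2 := by
    intro α hα β hβ hd
    have h1 := Finset.card_union_add_card_inter α β
    have h2 : 0 < (α ∩ β).card := Finset.card_pos.2 (by
      rwa [Finset.nonempty_iff_ne_empty, Ne, ← Finset.disjoint_iff_inter_eq_empty])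
    rw [hScard α hα, hScard β hβ] at h1
    omega
  have hmain := abs_measureReal_sub_exp_le P S (starEvent N X r)
    (fun β _ => measurableSet_starEvent N (fun i _ => hXm i) r) (fun α β => ¬ Disjoint α β)
    (fun α hα => by
      rw [disjoint_self, Finset.bot_eq_empty, ← Finset.card_eq_zero, hScard α hα]
      omega)
    (fun α _ => indepFun_starEvent_eventCount N hXm hXi r hSsub α)
  have hsum : ∑ α ∈ S, P.real (starEvent N X r α) = n.choose (k + 1) * p := by
    rw [Finset.sum_congr rfl hprob, Finset.sum_const, hS, Finset.card_powersetCard,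
      Finset.card_range, nsmul_eq_mul]
  rw [hsum] at hmain
  clear_value S
  refine hmain.trans (add_le_add ?_ ?_)
  · refine le_trans (Finset.sum_le_sum fun α hα => Finset.sum_le_sum fun β hβ => ?_)
      (sum_sum_card_union_le n S hSsub (fun α => S.filter fun β => ¬ Disjoint α β)
        (fun α _ => Finset.filter_subset _ _) (Finset.range (2 * k + 2)) ?_
        (fun _ => p ^ 2) fun _ => sq_nonneg p)
    · rw [hprob α hα, hprob β (Finset.mem_filter.1 hβ).1, sq]
    · intro α hα β hβ
      exact Finset.mem_range.2
        (hunion α hα β (Finset.mem_filter.1 hβ).1 (Finset.mem_filter.1 hβ).2)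
  · refine le_trans (Finset.sum_le_sum fun α hα => Finset.sum_le_sum fun β hβ =>
        measureReal_starEvent_inter_le N hN hC hfC hν hXm hXi hXl hr
              (Finset.mem_filter.1 (Finset.mem_of_mem_erase hβ)).2)
      (sum_sum_card_union_le n S hSsub (fun α => (S.filter fun β => ¬ Disjoint α β).erase α)
        (fun α _ => (Finset.erase_subset _ _).trans (Finset.filter_subset _ _))
        (Finset.Ico (k + 2) (2 * k + 2)) ?_
        (fun m => (C * 2 ^ d * (volume {x | N x ≤ 1}).toReal * r ^ d) ^ (m - 1))
        fun m => by positivity)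
    intro α hα β hβ
    have hβ' := Finset.mem_filter.1 (Finset.mem_of_mem_erase hβ)
    refine Finset.mem_Ico.2 ⟨?_, hunion α hα β hβ'.1 hβ'.2⟩
    by_contra hlt
    have hle : (α ∪ β).card ≤ α.card := by
      rw [hScard α hα]; omega
    have h1 : α = α ∪ β := Finset.eq_of_subset_of_card_le Finset.subset_union_left hle
    have h2 : β ⊆ α := by
      rw [h1]; exact Finset.subset_union_right
    exact Finset.ne_of_mem_erase hβ (Finset.eq_of_subset_of_card_le h2
      (by rw [hScard α hα, hScard β hβ'.1]))

/-- If `n ^ (k + 1) r_n ^ (d k) = T`, the mean number of stars of radius `r_n` tends to `T μ_{d,k}`,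
while both error terms of the Poisson approximation tend to `0`. -/
theorem tendsto_measureReal_no_star (hd : 1 ≤ d) (N : Seminorm ℝ (Fin d → ℝ))
    (hN : ∀ x, N x = 0 → x = 0) {f : (Fin d → ℝ) → ℝ} (hfm : Measurable f) (hf0 : ∀ x, 0 ≤ f x)
    {C : ℝ} (hC : 1 ≤ C) (hfC : ∀ x, f x ≤ C) [IsProbabilityMeasure ν]
    (hν : ν = volume.withDensity fun x => ENNReal.ofReal (f x))
    (hXm : ∀ i, Measurable (X i)) (hXi : iIndepFun X P) (hXl : ∀ i, P.map (X i) = ν) (k : ℕ)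
    {r : ℕ → ℝ} (hr : ∀ᶠ n in atTop, 0 < r n) (hr0 : Tendsto r atTop (𝓝 0))
    (hrd : Tendsto (fun n : ℕ => (n : ℝ) * r n ^ d) atTop (𝓝 0)) {T : ℝ}
    (hT : ∀ᶠ n : ℕ in atTop, (n : ℝ) ^ (k + 1) * r n ^ (d * k) = T) :
    Tendsto (fun n : ℕ => P.real {ω | ∀ α ∈ Finset.powersetCard (k + 1) (Finset.range n),
      ω ∉ starEvent N X (r n) α}) atTop (𝓝 (Real.exp (-(T * (totalMass N f k).toReal)))) := by
  set p : ℕ → ℝ := fun n =>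
    (Measure.pi fun _ : Fin (k + 1) => ν).real {x | HasCenter N (r n) x} with hp
  set I := ((∫⁻ x, ENNReal.ofReal (f x) ^ (k + 1)) * volume (unitStars N k)).toReal with hI
  have hpr : Tendsto (fun n => p n / r n ^ (d * k)) atTop (𝓝 I) :=
    (tendsto_pi_hasCenter_div N hN hfm hf0 hC hfC hν k).comp
      (tendsto_nhdsWithin_iff.2 ⟨hr0, hr⟩)
  have hnp : Tendsto (fun n : ℕ => (n : ℝ) ^ (k + 1) * p n) atTop (𝓝 (T * I)) := by
    refine (hpr.const_mul T).congr' ?_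
    filter_upwards [hr, hT] with n h1 h2
    have : r n ^ (d * k) ≠ 0 := pow_ne_zero _ h1.ne'
    rw [← h2]
    field_simp
  have hlam : Tendsto (fun n : ℕ => (n.choose (k + 1) : ℝ) * p n) atTop
      (𝓝 (T * (totalMass N f k).toReal)) := by
    have hz : ∀ᶠ n : ℕ in atTop, (n : ℝ) ^ (k + 1) / ((k + 1).factorial : ℝ) ≠ 0 := by
      filter_upwards [eventually_gt_atTop 0] with n hn
      have : (0 : ℝ) < n := by exact_mod_cast hn
      positivity
    have h1 := (Asymptotics.isEquivalent_iff_tendsto_one hz).1 (isEquivalent_choose (k + 1))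
    have h2 := (h1.mul hnp).div_const ((k + 1).factorial : ℝ)
    have e : 1 * (T * I) / ((k + 1).factorial : ℝ) = T * (totalMass N f k).toReal := by
      rw [totalMass_eq hd, ENNReal.toReal_mul, ENNReal.toReal_inv, ENNReal.toReal_natCast, ← hI]
      ring
    rw [e] at h2
    refine h2.congr' ?_
    filter_upwards [eventually_gt_atTop 0] with n hn
    have hn' : (n : ℝ) ≠ 0 := by exact_mod_cast hn.ne'
    have hk' : ((k + 1).factorial : ℝ) ≠ 0 := by exact_mod_cast (Nat.factorial_pos _).ne'
    simp only [Pi.div_apply]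
    field_simp
  set K := C * 2 ^ d * (volume {x | N x ≤ 1}).toReal with hK
  -- each summand is `n ^ m p_n ^ 2` with `m ≤ 2 k + 1`, and `n ^ (k + 1) p_n` converges
  have hb1 : Tendsto (fun n : ℕ => ∑ m ∈ Finset.range (2 * k + 2),
      (n : ℝ) ^ m * 4 ^ m * p n ^ 2) atTop (𝓝 0) := by
    have : (0 : ℝ) = ∑ m ∈ Finset.range (2 * k + 2), (4 : ℝ) ^ m * (0 * (T * I) ^ 2) := by simp
    rw [this]
    refine tendsto_finsetSum _ fun m hm => ?_
    have hpow : Tendsto (fun n : ℕ => (n : ℝ) ^ m / (n : ℝ) ^ (2 * k + 2)) atTop (𝓝 0) :=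
      (tendsto_pow_div_pow_atTop_zero (𝕜 := ℝ) (Finset.mem_range.1 hm)).comp
        tendsto_natCast_atTop_atTop
    refine ((hpow.mul (hnp.pow 2)).const_mul ((4 : ℝ) ^ m)).congr' ?_
    filter_upwards [eventually_gt_atTop 0] with n hn
    have hn' : (n : ℝ) ≠ 0 := by exact_mod_cast hn.ne'
    have e : (n : ℝ) ^ (2 * k + 2) = ((n : ℝ) ^ (k + 1)) ^ 2 := by ring
    rw [e]
    field_simp
  -- for `m = k + 1 + j`, `n ^ m (r_n ^ d) ^ (m - 1) = T (n r_n ^ d) ^ j`, and `j ≥ 1`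
  have hb2 : Tendsto (fun n : ℕ => ∑ m ∈ Finset.Ico (k + 2) (2 * k + 2),
      (n : ℝ) ^ m * 4 ^ m * (K * r n ^ d) ^ (m - 1)) atTop (𝓝 0) := by
    have : (0 : ℝ) = ∑ m ∈ Finset.Ico (k + 2) (2 * k + 2),
        (4 : ℝ) ^ m * K ^ (m - 1) * T * 0 ^ (m - (k + 1)) := by
      refine (Finset.sum_eq_zero fun m hm => ?_).symm
      have := (Finset.mem_Ico.1 hm).1
      rw [zero_pow (by omega), mul_zero]
    rw [this]
    refine tendsto_finsetSum _ fun m hm => ?_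
    obtain ⟨j, rfl⟩ : ∃ j, m = k + 1 + j :=
      ⟨m - (k + 1), by have := (Finset.mem_Ico.1 hm).1; omega⟩
    refine ((hrd.pow (k + 1 + j - (k + 1))).const_mul
      ((4 : ℝ) ^ (k + 1 + j) * K ^ (k + 1 + j - 1) * T)).congr' ?_
    filter_upwards [hT] with n hn
    have e1 : k + 1 + j - (k + 1) = j := by omega
    have e2 : k + 1 + j - 1 = k + j := by omega
    rw [← hn, e1, e2]
    ring
  have hexp : Tendsto (fun n : ℕ => Real.exp (-((n.choose (k + 1) : ℝ) * p n))) atTop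
      (𝓝 (Real.exp (-(T * (totalMass N f k).toReal)))) :=
    (Real.continuous_exp.tendsto _).comp hlam.neg
  have hdiff := squeeze_zero_norm' (a := fun n : ℕ =>
      (∑ m ∈ Finset.range (2 * k + 2), (n : ℝ) ^ m * 4 ^ m * p n ^ 2) +
        ∑ m ∈ Finset.Ico (k + 2) (2 * k + 2), (n : ℝ) ^ m * 4 ^ m * (K * r n ^ d) ^ (m - 1))
    (f := fun n : ℕ => P.real {ω | ∀ α ∈ Finset.powersetCard (k + 1) (Finset.range n),
      ω ∉ starEvent N X (r n) α} - Real.exp (-((n.choose (k + 1) : ℝ) * p n)))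
    (by
      filter_upwards [hr] with n hn
      rw [Real.norm_eq_abs]
      exact abs_measureReal_no_star_sub_exp_le N hN (by linarith) hfC hν hXm hXi hXl hn k n rfl)
    (by simpa using hb1.add hb2)
  simpa using hdiff.add hexp

end StarEvents

/-! ### The threshold radius -/

section ThresholdRadius

variable {d : ℕ} {Ω : Type*}

open Classical in
/-- For distinct points, some vertex has degree at least `k` exactly when some `k + 1` of the points
form a star. -/
theorem le_maxDegree_iff_exists_star (N : Seminorm ℝ (Fin d → ℝ)) (X : ℕ → Ω → Fin d → ℝ) {k n : ℕ}
    (hk : 1 ≤ k) {ω : Ω} (hinj : Function.Injective fun i : Fin n => X i ω) (r : ℝ) :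
    k ≤ (geometricGraph N (binomialPoints X n ω) r).maxDegree ↔
      ∃ α ∈ Finset.powersetCard (k + 1) (Finset.range n), ω ∈ starEvent N X r α := by
  set G := tupleGraph N r (fun i : Fin n => X i ω) with hG
  obtain ⟨e⟩ := nonempty_tupleGraph_iso N r hinj (s := binomialPoints X n ω) fun p => by
    simp [binomialPoints, Fin.exists_iff]
  rw [← e.maxDegree_eq]
  constructor
  · intro h
    have hne : Nonempty (Fin n) := by
      by_contra hem
      rw [not_nonempty_iff] at hem
      rw [SimpleGraph.maxDegree_of_subsingleton] at h
      omega
    obtain ⟨v, hv⟩ := G.exists_maximal_degree_vertex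
    rw [hv, ← SimpleGraph.card_neighborFinset_eq_degree] at h
    obtain ⟨J, hJ, hJc⟩ := Finset.exists_subset_card_eq h
    have hJadj : ∀ j ∈ J, G.Adj v j := fun j hj => by simpa using hJ hj
    have hvJ : v ∉ J := fun hv => (hJadj v hv).ne rfl
    refine ⟨(insert v J).map Fin.valEmbedding, Finset.mem_powersetCard.2 ⟨?_, ?_⟩, (v : ℕ), ?_, ?_⟩
    · intro i hi
      obtain ⟨j, -, rfl⟩ := Finset.mem_map.1 hi
      exact Finset.mem_range.2 j.2
    · rw [Finset.card_map, Finset.card_insert_of_notMem hvJ, hJc]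
    · exact Finset.mem_map.2 ⟨v, Finset.mem_insert_self _ _, rfl⟩
    · intro i hi
      obtain ⟨j, hj, rfl⟩ := Finset.mem_map.1 hi
      obtain ⟨w, hw⟩ : ∃ w, G.Adj v w := by
        have : J.Nonempty := Finset.card_pos.1 (by omega)
        exact ⟨_, hJadj _ this.choose_spec⟩
      rcases Finset.mem_insert.1 hj with rfl | hj
      · simpa using (apply_nonneg N _).trans hw.2
      · exact (hJadj j hj).2
  · rintro ⟨α, hα, i, hi, h⟩
    obtain ⟨hsub, hcard⟩ := Finset.mem_powersetCard.1 hα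
    set v : Fin n := ⟨i, Finset.mem_range.1 (hsub hi)⟩ with hv
    refine le_trans ?_ (G.degree_le_maxDegree v)
    set J : Finset (Fin n) := Finset.univ.filter fun j => (j : ℕ) ∈ α ∧ (j : ℕ) ≠ i with hJ
    have hJmap : J.map Fin.valEmbedding = α.erase i := by
      ext j
      simp only [hJ, Finset.mem_map, Finset.mem_filter, Finset.mem_univ, true_and,
        Fin.valEmbedding_apply, Finset.mem_erase]
      constructor
      · rintro ⟨a, ⟨h1, h2⟩, rfl⟩
        exact ⟨h2, h1⟩
      · rintro ⟨h1, h2⟩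
        exact ⟨⟨j, Finset.mem_range.1 (hsub h2)⟩, ⟨h2, h1⟩, rfl⟩
    have hJcard : J.card = k := by
      rw [← Finset.card_map Fin.valEmbedding, hJmap, Finset.card_erase_of_mem hi, hcard,
        Nat.add_sub_cancel]
    rw [← SimpleGraph.card_neighborFinset_eq_degree, ← hJcard]
    refine Finset.card_le_card fun j hj => ?_
    obtain ⟨-, hj1, hj2⟩ := Finset.mem_filter.1 hj
    rw [SimpleGraph.mem_neighborFinset]
    exact ⟨fun hvj => hj2 (by rw [← hvj]), h j hj1⟩

theorem thresholdRadius_nonneg (N : Seminorm ℝ (Fin d → ℝ)) (k : ℕ) (s : Finset (Fin d → ℝ)) :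
    0 ≤ thresholdRadius N k s :=
  Real.sInf_nonneg fun _ hr => hr.1.le

/-- With at most `k` points no degree reaches `k`, and the infimum is that of the empty set. -/
theorem thresholdRadius_eq_zero_of_card_le (N : Seminorm ℝ (Fin d → ℝ)) {k : ℕ} (hk : 1 ≤ k)
    {s : Finset (Fin d → ℝ)} (hs : s.card ≤ k) : thresholdRadius N k s = 0 := by
  classical
  rw [thresholdRadius]
  convert Real.sInf_empty
  refine Set.eq_empty_of_forall_notMem fun r hr => ?_
  have h := hr.2
  rcases isEmpty_or_nonempty s with hem | hne
  · rw [SimpleGraph.maxDegree_of_subsingleton] at h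
    omega
  · have := (geometricGraph N s r).maxDegree_lt_card_verts
    rw [Fintype.card_coe] at this
    omega

theorem starEvent_mono (N : Seminorm ℝ (Fin d → ℝ)) (X : ℕ → Ω → Fin d → ℝ) {r r' : ℝ}
    (h : r ≤ r') (α : Finset ℕ) : starEvent N X r α ⊆ starEvent N X r' α :=
  fun _ ⟨i, hi, hij⟩ => ⟨i, hi, fun j hj => (hij j hj).trans h⟩

/-- The threshold radius is at most `r` exactly when there is a star of radius `r`: the infimum is
attained, because a finite configuration has only finitely many distances. -/
theorem thresholdRadius_le_iff (N : Seminorm ℝ (Fin d → ℝ)) (hN : ∀ x, N x = 0 → x = 0)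
    (X : ℕ → Ω → Fin d → ℝ) {k n : ℕ} (hk : 1 ≤ k) (hn : k < n) {ω : Ω}
    (hinj : Function.Injective fun i : Fin n => X i ω) (r : ℝ) :
    thresholdRadius N k (binomialPoints X n ω) ≤ r ↔
      ∃ α ∈ Finset.powersetCard (k + 1) (Finset.range n), ω ∈ starEvent N X r α := by
  classical
  set S := Finset.powersetCard (k + 1) (Finset.range n) with hS
  have hset : thresholdRadius N k (binomialPoints X n ω) =
      sInf {r : ℝ | 0 < r ∧ ∃ α ∈ S, ω ∈ starEvent N X r α} := by
    rw [thresholdRadius]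
    congr 1
    ext u
    refine and_congr_right fun _ => ?_
    convert le_maxDegree_iff_exists_star N X hk hinj u
  rw [hset]
  constructor
  · intro hle
    by_contra hno
    push Not at hno
    -- finitely many strict inequalities between `r` and distances persist slightly above `r`
    have hev : ∀ᶠ u in 𝓝[>] r, ∀ α ∈ S, ω ∉ starEvent N X u α := by
      rw [Filter.eventually_all_finset]
      intro α hα
      have h1 : ∀ᶠ u in 𝓝[>] r, ∀ i ∈ α, ∃ j ∈ α, u < N (X i ω - X j ω) := by
        rw [Filter.eventually_all_finset]
        intro i hi
        have hno' := hno α hα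
        simp only [starEvent, Set.mem_ofPred_eq, not_exists, not_and, not_forall, not_le] at hno'
        obtain ⟨j, hj, hij⟩ := hno' i hi
        filter_upwards [nhdsWithin_le_nhds (Iio_mem_nhds hij)] with u hu
        exact ⟨j, hj, hu⟩
      filter_upwards [h1] with u hu
      rintro ⟨i, hi, h⟩
      obtain ⟨j, hj, hij⟩ := hu i hi
      exact absurd (h j hj) (not_le.2 hij)
    obtain ⟨u, hu, hur⟩ := (hev.and self_mem_nhdsWithin).exists
    have hne : {r : ℝ | 0 < r ∧ ∃ α ∈ S, ω ∈ starEvent N X r α}.Nonempty := by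
      obtain ⟨α, hα⟩ := Finset.powersetCard_nonempty.2
        (show k + 1 ≤ (Finset.range n).card by rw [Finset.card_range]; omega)
      obtain ⟨i, hi⟩ : α.Nonempty := Finset.card_pos.1 (by
        rw [(Finset.mem_powersetCard.1 hα).2]; omega)
      refine ⟨∑ j ∈ α, N (X i ω - X j ω) + 1, ?_, α, hα, i, hi, fun j hj => ?_⟩
      · have : 0 ≤ ∑ j ∈ α, N (X i ω - X j ω) := Finset.sum_nonneg fun _ _ => apply_nonneg N _
        linarith
      · have := Finset.single_le_sum (f := fun j => N (X i ω - X j ω))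
          (fun _ _ => apply_nonneg N _) hj
        linarith
    have : u ≤ sInf {r : ℝ | 0 < r ∧ ∃ α ∈ S, ω ∈ starEvent N X r α} := by
      refine le_csInf hne ?_
      rintro v ⟨-, α, hα, hv⟩
      by_contra hvu
      exact hu α hα (starEvent_mono N X (not_le.1 hvu).le α hv)
    have hur' : r < u := hur
    linarith
  · rintro ⟨α, hα, hstar⟩
    -- a star contains two distinct points at distance at most `r`
    have hr : 0 < r := by
      obtain ⟨i, hi, h⟩ := hstar
      obtain ⟨hsub, hcard⟩ := Finset.mem_powersetCard.1 hα
      obtain ⟨j, hj, hji⟩ := Finset.exists_mem_ne (by omega : 1 < α.card) i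
      refine lt_of_lt_of_le (lt_of_le_of_ne (apply_nonneg N _) fun h0 => hji ?_) (h j hj)
      have := sub_eq_zero.1 (hN _ h0.symm)
      have h2 := @hinj ⟨i, Finset.mem_range.1 (hsub hi)⟩ ⟨j, Finset.mem_range.1 (hsub hj)⟩ this
      exact (congrArg Fin.val h2).symm
    exact csInf_le ⟨0, fun u hu => hu.1.le⟩ ⟨hr, α, hα, hstar⟩

variable [MeasurableSpace Ω] {P : Measure Ω} [IsProbabilityMeasure P] {X : ℕ → Ω → Fin d → ℝ}

theorem measurableSet_injective (hXm : ∀ i, Measurable (X i)) (n : ℕ) :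
    MeasurableSet {ω | Function.Injective fun i : Fin n => X i ω} := by
  have : {ω | Function.Injective fun i : Fin n => X i ω} =
      ⋂ i : Fin n, ⋂ j : Fin n, ⋂ _ : i ≠ j, {ω | X i ω = X j ω}ᶜ := by
    ext ω
    simp only [Set.mem_ofPred_eq, Set.mem_iInter, Set.mem_compl_iff]
    exact ⟨fun h i j hij heq => hij (h heq), fun h i j heq => by
      by_contra hij
      exact h i j hij heq⟩
  rw [this]
  exact MeasurableSet.iInter fun i => MeasurableSet.iInter fun j => MeasurableSet.iInter fun _ =>
    (measurableSet_eq_fun (hXm i) (hXm j)).compl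

theorem ae_injective (hd : 1 ≤ d) {g : (Fin d → ℝ) → ℝ≥0∞} (hXm : ∀ i, Measurable (X i))
    (hXi : iIndepFun X P) (hXl : ∀ i, P.map (X i) = volume.withDensity g) (n : ℕ) :
    ∀ᵐ ω ∂P, Function.Injective fun i : Fin n => X i ω := by
  have hne : Nonempty (Fin d) := ⟨⟨0, hd⟩⟩
  have h : ∀ i j : ℕ, i ≠ j → ∀ᵐ ω ∂P, X i ω ≠ X j ω := by
    intro i j hij
    have hmap := (indepFun_iff_map_prod_eq_prod_map_map (hXm i).aemeasurable
      (hXm j).aemeasurable).1 (hXi.indepFun hij)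
    have hprob : IsProbabilityMeasure (volume.withDensity g) :=
      hXl 0 ▸ Measure.isProbabilityMeasure_map (hXm 0).aemeasurable
    rw [hXl, hXl] at hmap
    have hdiag : ((volume.withDensity g).prod (volume.withDensity g))
        (Set.diagonal (Fin d → ℝ)) = 0 := by
      rw [Measure.prod_apply measurableSet_diagonal]
      refine lintegral_eq_zero_of_ae_eq_zero (Eventually.of_forall fun x => ?_)
      refine withDensity_absolutelyContinuous volume g ?_
      have : Prod.mk x ⁻¹' Set.diagonal (Fin d → ℝ) = {x} := by
        ext y; simp [eq_comm]
      rw [this]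
      exact measure_singleton x
    rw [← hmap, Measure.map_apply ((hXm i).prodMk (hXm j)) measurableSet_diagonal] at hdiag
    rw [ae_iff]
    simpa [Set.preimage, Set.diagonal] using hdiag
  filter_upwards [ae_all_iff.2 fun i => ae_all_iff.2 fun j => ae_all_iff.2 fun hij => h i j hij]
    with ω hω i j hij
  by_contra hne
  exact hω i j (fun h => hne (Fin.ext h)) hij

/-- Measurability holds only almost everywhere by this argument: the description by star events
needs the points to be distinct. -/
theorem aemeasurable_thresholdRadius (hd : 1 ≤ d) (N : Seminorm ℝ (Fin d → ℝ))
    (hN : ∀ x, N x = 0 → x = 0) {g : (Fin d → ℝ) → ℝ≥0∞} (hXm : ∀ i, Measurable (X i))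
    (hXi : iIndepFun X P) (hXl : ∀ i, P.map (X i) = volume.withDensity g) {k : ℕ} (hk : 1 ≤ k)
    (n : ℕ) : AEMeasurable (fun ω => thresholdRadius N k (binomialPoints X n ω)) P := by
  classical
  rcases Nat.lt_or_ge k n with hn | hn
  · set A : Set Ω := {ω | Function.Injective fun i : Fin n => X i ω} with hA
    have hAm : MeasurableSet A := measurableSet_injective hXm n
    refine ⟨A.indicator fun ω => thresholdRadius N k (binomialPoints X n ω), ?_, ?_⟩
    · refine measurable_of_Iic fun r => ?_
      have hstar : MeasurableSet (⋃ α ∈ Finset.powersetCard (k + 1) (Finset.range n),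
          starEvent N X r α) :=
        Finset.measurableSet_biUnion _ fun α _ => measurableSet_starEvent N (fun i _ => hXm i) r
      have : A.indicator (fun ω => thresholdRadius N k (binomialPoints X n ω)) ⁻¹' Set.Iic r =
          (A ∩ ⋃ α ∈ Finset.powersetCard (k + 1) (Finset.range n), starEvent N X r α) ∪
            (Aᶜ ∩ {_ω | 0 ≤ r}) := by
        ext ω
        by_cases hω : ω ∈ A
        · have := thresholdRadius_le_iff N hN X hk hn hω r
          simp [hω, this]
        · simp [hω]
      rw [this]
      exact (hAm.inter hstar).union (hAm.compl.inter (MeasurableSet.const _))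
    · filter_upwards [ae_injective hd hXm hXi hXl n] with ω hω
      rw [Set.indicator_of_mem (show ω ∈ A from hω)]
  · have : (fun ω => thresholdRadius N k (binomialPoints X n ω)) = fun _ => 0 := by
      funext ω
      refine thresholdRadius_eq_zero_of_card_le N hk ?_
      rw [binomialPoints]
      exact (Finset.card_image_le.trans_eq (Finset.card_range n)).trans hn
    rw [this]
    exact aemeasurable_const

end ThresholdRadius

/-! ### The negative Weibull law and convergence of distribution functions -/

section Weibull

/-- The distribution function `x ↦ exp (-c (max (-x) 0) ^ m)` of the negative Weibull law. -/
noncomputable def weibullStieltjes (c : ℝ) (hc : 0 ≤ c) (m : ℕ) : StieltjesFunction ℝ where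
  toFun x := Real.exp (-(c * max (-x) 0 ^ m))
  mono' x y hxy := by
    refine Real.exp_le_exp.2 (neg_le_neg (mul_le_mul_of_nonneg_left ?_ hc))
    exact pow_le_pow_left₀ (le_max_right _ _) (max_le_max (neg_le_neg hxy) le_rfl) m
  right_continuous' x := by
    have : Continuous fun x : ℝ => Real.exp (-(c * max (-x) 0 ^ m)) := by fun_prop
    exact this.continuousWithinAt

theorem weibullStieltjes_apply {c : ℝ} (hc : 0 ≤ c) (m : ℕ) (x : ℝ) :
    weibullStieltjes c hc m x = Real.exp (-(c * max (-x) 0 ^ m)) := rfl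

theorem tendsto_weibullStieltjes_atBot {c : ℝ} (hc : 0 < c) {m : ℕ} (hm : m ≠ 0) :
    Tendsto (weibullStieltjes c hc.le m) atBot (𝓝 0) := by
  have h1 : Tendsto (fun x : ℝ => max (-x) 0) atBot atTop :=
    tendsto_atTop_mono (fun x => le_max_left _ _) tendsto_neg_atBot_atTop
  have h2 := ((tendsto_pow_atTop hm).comp h1).const_mul_atTop hc
  exact Real.tendsto_exp_atBot.comp (tendsto_neg_atTop_atBot.comp h2)

theorem tendsto_weibullStieltjes_atTop {c : ℝ} (hc : 0 ≤ c) {m : ℕ} (hm : m ≠ 0) :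
    Tendsto (weibullStieltjes c hc m) atTop (𝓝 1) := by
  refine tendsto_const_nhds.congr' ?_
  filter_upwards [eventually_ge_atTop 0] with x hx
  rw [weibullStieltjes_apply, max_eq_right (by linarith), zero_pow hm]
  simp

theorem exists_probabilityMeasure_weibull {c : ℝ} (hc : 0 < c) {m : ℕ} (hm : m ≠ 0) :
    ∃ ν : ProbabilityMeasure ℝ, ∀ x : ℝ, (ν : Measure ℝ).real (Set.Iic x) =
      Real.exp (-(c * max (-x) 0 ^ m)) := by
  refine ⟨⟨(weibullStieltjes c hc.le m).measure, StieltjesFunction.isProbabilityMeasure _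
    (tendsto_weibullStieltjes_atBot hc hm) (tendsto_weibullStieltjes_atTop hc.le hm)⟩, fun x => ?_⟩
  rw [ProbabilityMeasure.coe_mk, measureReal_def,
    StieltjesFunction.measure_Iic _ (tendsto_weibullStieltjes_atBot hc hm), sub_zero,
    weibullStieltjes_apply, ENNReal.toReal_ofReal (Real.exp_pos _).le]

theorem tendsto_probabilityMeasure_of_tendsto_Iic {μ : ℕ → ProbabilityMeasure ℝ}
    {ν : ProbabilityMeasure ℝ}
    (h : ∀ x : ℝ, Tendsto (fun n => (μ n : Measure ℝ).real (Set.Iic x)) atTop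
      (𝓝 ((ν : Measure ℝ).real (Set.Iic x)))) : Tendsto μ atTop (𝓝 ν) := by
  have hIoc : ∀ (ρ : ProbabilityMeasure ℝ) {a b : ℝ}, a < b → (ρ : Measure ℝ).real (Set.Ioc a b) =
      (ρ : Measure ℝ).real (Set.Iic b) - (ρ : Measure ℝ).real (Set.Iic a) := by
    intro ρ a b hab
    rw [← Set.Iic_sdiff_Iic, measureReal_sdiff (Set.Iic_subset_Iic.2 hab.le) measurableSet_Iic]
  refine IsPiSystem.tendsto_probabilityMeasure_of_tendsto_of_mem
    (isPiSystem_Ioc (id : ℝ → ℝ) id) ?_ ?_ ?_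
  · rintro s ⟨a, b, -, rfl⟩
    exact measurableSet_Ioc
  · intro u hu x hx
    obtain ⟨ε, hε, hball⟩ := Metric.isOpen_iff.1 hu x hx
    refine ⟨Set.Ioc (x - ε / 2) (x + ε / 2), ⟨_, _, by simp only [id]; linarith, rfl⟩,
      Ioc_mem_nhds (by linarith) (by linarith), fun y hy => hball ?_⟩
    rw [Metric.mem_ball, Real.dist_eq, abs_lt]
    constructor <;> linarith [hy.1, hy.2]
  · rintro s ⟨a, b, hab, rfl⟩
    rw [← NNReal.tendsto_coe]
    have : ∀ ρ : ProbabilityMeasure ℝ, ((ρ (Set.Ioc (id a) (id b)) : NNReal) : ℝ) =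
        (ρ : Measure ℝ).real (Set.Iic b) - (ρ : Measure ℝ).real (Set.Iic a) :=
      fun ρ => hIoc ρ hab
    simp_rw [this]
    exact (h b).sub (h a)

end Weibull

/-! ### The limit of the rescaled threshold radius -/

section Limit

variable {d : ℕ} {Ω : Type*} [MeasurableSpace Ω] {P : Measure Ω} [IsProbabilityMeasure P]
  {X : ℕ → Ω → Fin d → ℝ}

/-- The normalisation `n ^ a`, `a = (k + 1) / (d k)`, is chosen so that the radii `r = t n ^ (-a)`
satisfy `n ^ (k + 1) r ^ (d k) = t ^ (d k)`. -/
theorem rpow_exponent_pow_mul {d k : ℕ} (hd : 1 ≤ d) (hk : 1 ≤ k) {x : ℝ} (hx : 0 ≤ x) :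
    (x ^ (((k : ℝ) + 1) / ((d : ℝ) * (k : ℝ)))) ^ (d * k) = x ^ (k + 1) := by
  have hd' : (d : ℝ) ≠ 0 := by exact_mod_cast (by omega : d ≠ 0)
  have hk' : (k : ℝ) ≠ 0 := by exact_mod_cast (by omega : k ≠ 0)
  rw [← Real.rpow_natCast, ← Real.rpow_mul hx, ← Real.rpow_natCast x (k + 1)]
  congr 1
  push_cast
  field_simp

theorem rpow_exponent_pow {d k : ℕ} (hd : 1 ≤ d) (hk : 1 ≤ k) {x : ℝ} (hx : 0 < x) :
    (x ^ (((k : ℝ) + 1) / ((d : ℝ) * (k : ℝ)))) ^ d = x * x ^ (1 / (k : ℝ)) := by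
  have hd' : (d : ℝ) ≠ 0 := by exact_mod_cast (by omega : d ≠ 0)
  have hk' : (k : ℝ) ≠ 0 := by exact_mod_cast (by omega : k ≠ 0)
  conv_rhs => rw [← Real.rpow_one x]
  rw [← Real.rpow_natCast, ← Real.rpow_mul hx.le, Real.rpow_one, ← Real.rpow_one_add' hx.le
    (by positivity)]
  congr 1
  field_simp

/-- Convergence of `P[-n ^ a S_k < -t]` for the exponent `a = (k + 1) / (d k)`: the event says that
there is no star of radius `t n ^ (-a)`. -/
theorem tendsto_measureReal_lt_thresholdRadius (hd : 1 ≤ d) (N : Seminorm ℝ (Fin d → ℝ))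
    (hN : ∀ x, N x = 0 → x = 0) {f : (Fin d → ℝ) → ℝ} (hfm : Measurable f) (hf0 : ∀ x, 0 ≤ f x)
    {C : ℝ} (hC : 1 ≤ C) (hfC : ∀ x, f x ≤ C) (hXm : ∀ i, Measurable (X i)) (hXi : iIndepFun X P)
    (hXl : ∀ i, P.map (X i) = volume.withDensity fun x => ENNReal.ofReal (f x)) {k : ℕ}
    (hk : 1 ≤ k) {t : ℝ} (ht : 0 < t) :
    Tendsto (fun n : ℕ => P.real {ω | t < (n : ℝ) ^ (((k : ℝ) + 1) / ((d : ℝ) * (k : ℝ))) *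
      thresholdRadius N k (binomialPoints X n ω)}) atTop
      (𝓝 (Real.exp (-((totalMass N f k).toReal * t ^ (d * k))))) := by
  set a : ℝ := ((k : ℝ) + 1) / ((d : ℝ) * (k : ℝ)) with ha
  have hd' : (0 : ℝ) < d := by exact_mod_cast hd
  have hk' : (0 : ℝ) < k := by exact_mod_cast hk
  have ha0 : 0 < a := by positivity
  have hprob : IsProbabilityMeasure (volume.withDensity fun x : Fin d → ℝ => ENNReal.ofReal (f x)) :=
    hXl 0 ▸ Measure.isProbabilityMeasure_map (hXm 0).aemeasurable
  have hlim := tendsto_measureReal_no_star (r := fun n : ℕ => t / (n : ℝ) ^ a) (T := t ^ (d * k))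
    hd N hN hfm hf0 hC hfC rfl hXm hXi hXl k ?_ ?_ ?_ ?_
  · rw [mul_comm (totalMass N f k).toReal]
    refine hlim.congr' ?_
    filter_upwards [eventually_gt_atTop k] with n hn
    have hn0 : (0 : ℝ) < n := by exact_mod_cast (by omega : 0 < n)
    refine measureReal_congr ?_
    filter_upwards [ae_injective hd hXm hXi hXl n] with ω hω
    have h := thresholdRadius_le_iff N hN X hk hn hω (t / (n : ℝ) ^ a)
    refine propext ?_
    change (∀ α ∈ Finset.powersetCard (k + 1) (Finset.range n),
      ω ∉ starEvent N X (t / (n : ℝ) ^ a) α) ↔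
      t < (n : ℝ) ^ a * thresholdRadius N k (binomialPoints X n ω)
    rw [← div_lt_iff₀' (Real.rpow_pos_of_pos hn0 a), ← not_le, h]
    push Not
    rfl
  · filter_upwards [eventually_gt_atTop 0] with n hn
    have hn0 : (0 : ℝ) < n := by exact_mod_cast hn
    positivity
  · exact ((tendsto_rpow_atTop ha0).comp tendsto_natCast_atTop_atTop).const_div_atTop t
  · have h0 : Tendsto (fun n : ℕ => t ^ d / (n : ℝ) ^ (1 / (k : ℝ))) atTop (𝓝 0) :=
      ((tendsto_rpow_atTop (by positivity)).comp tendsto_natCast_atTop_atTop).const_div_atTop _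
    refine h0.congr' ?_
    filter_upwards [eventually_gt_atTop 0] with n hn
    have hn0 : (0 : ℝ) < n := by exact_mod_cast hn
    rw [div_pow, rpow_exponent_pow hd hk hn0]
    field_simp
  · filter_upwards [eventually_gt_atTop 0] with n hn
    have hn0 : (0 : ℝ) < n := by exact_mod_cast hn
    rw [div_pow, rpow_exponent_pow_mul hd hk hn0.le]
    field_simp

/-- Passing from `P[Z < x]` to `P[Z ≤ x]` uses the continuity of the limiting distribution
function. -/
theorem tendsto_measureReal_neg_thresholdRadius_le (hd : 1 ≤ d) (N : Seminorm ℝ (Fin d → ℝ))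
    (hN : ∀ x, N x = 0 → x = 0) {f : (Fin d → ℝ) → ℝ} (hfm : Measurable f) (hf0 : ∀ x, 0 ≤ f x)
    {C : ℝ} (hC : 1 ≤ C) (hfC : ∀ x, f x ≤ C) (hXm : ∀ i, Measurable (X i)) (hXi : iIndepFun X P)
    (hXl : ∀ i, P.map (X i) = volume.withDensity fun x => ENNReal.ofReal (f x)) {k : ℕ}
    (hk : 1 ≤ k) (x : ℝ) :
    Tendsto (fun n : ℕ => P.real {ω | -((n : ℝ) ^ (((k : ℝ) + 1) / ((d : ℝ) * (k : ℝ))) *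
      thresholdRadius N k (binomialPoints X n ω)) ≤ x}) atTop
      (𝓝 (Real.exp (-((totalMass N f k).toReal * max (-x) 0 ^ (d * k))))) := by
  set Y : ℕ → Ω → ℝ := fun n ω => (n : ℝ) ^ (((k : ℝ) + 1) / ((d : ℝ) * (k : ℝ))) *
      thresholdRadius N k (binomialPoints X n ω) with hY
  set F : ℝ → ℝ := fun x => Real.exp (-((totalMass N f k).toReal * max (-x) 0 ^ (d * k))) with hF
  change Tendsto (fun n : ℕ => P.real {ω | -Y n ω ≤ x}) atTop (𝓝 (F x))
  have hFc : Continuous F := by fun_prop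
  rcases lt_or_ge x 0 with hx | hx
  · have hlt : ∀ y < 0, Tendsto (fun n : ℕ => P.real {ω | -y < Y n ω}) atTop (𝓝 (F y)) := by
      intro y hy
      have h := tendsto_measureReal_lt_thresholdRadius hd N hN hfm hf0 hC hfC hXm hXi hXl hk
        (neg_pos.2 hy)
      rw [hF]
      simp only [max_eq_left (neg_pos.2 hy).le]
      exact h
    rw [tendsto_order]
    constructor
    · intro b hb
      filter_upwards [(tendsto_order.1 (hlt x hx)).1 b hb] with n hn
      refine hn.trans_le (measureReal_mono fun ω (hω : -x < Y n ω) => ?_)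
      change -Y n ω ≤ x
      linarith
    · intro b hb
      have hnear : ∀ᶠ y in 𝓝[>] x, F y < b :=
        nhdsWithin_le_nhds (hFc.continuousAt.eventually_lt continuousAt_const hb)
      have hneg : ∀ᶠ y in 𝓝[>] x, y < 0 := nhdsWithin_le_nhds (Iio_mem_nhds hx)
      obtain ⟨y, ⟨hyb, hy0⟩, hxy⟩ := ((hnear.and hneg).and self_mem_nhdsWithin).exists
      have hxy' : x < y := hxy
      filter_upwards [(tendsto_order.1 (hlt y hy0)).2 b hyb] with n hn
      refine lt_of_le_of_lt (measureReal_mono fun ω (hω : -Y n ω ≤ x) => ?_) hn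
      change -y < Y n ω
      linarith
  · have h1 : F x = 1 := by
      simp only [hF]
      rw [max_eq_right (by linarith), zero_pow (Nat.mul_ne_zero (by omega) (by omega))]
      simp
    rw [h1]
    refine tendsto_const_nhds.congr fun n => ?_
    have : {ω | -Y n ω ≤ x} = Set.univ := by
      refine Set.eq_univ_of_forall fun ω => ?_
      have : 0 ≤ Y n ω := mul_nonneg (Real.rpow_nonneg (Nat.cast_nonneg n) _)
        (thresholdRadius_nonneg N k _)
      change -Y n ω ≤ x
      linarith
    rw [this, probReal_univ]

end Limit

end RandomGeometricGraph

theorem mainTheorem1 (d k : ℕ) (hd : 1 ≤ d) (hk : 1 ≤ k)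
    -- an arbitrary norm on `ℝ^d`
    (N : Seminorm ℝ (Fin d → ℝ)) (hN : ∀ x, N x = 0 → x = 0)
    -- an (essentially) bounded density
    (f : (Fin d → ℝ) → ℝ) (hf_meas : Measurable f) (hf_nonneg : ∀ x, 0 ≤ f x)
    (hf_bdd : ∃ C : ℝ, ∀ᵐ x, f x ≤ C)
    -- an i.i.d. sequence with density `f`
    {Ω : Type*} [MeasurableSpace Ω] (P : Measure Ω) [IsProbabilityMeasure P]
    (X : ℕ → Ω → (Fin d → ℝ)) (hX_meas : ∀ i, Measurable (X i)) (hX_indep : iIndepFun X P)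
    (hX_law : ∀ i, P.map (X i) = volume.withDensity fun x => ENNReal.ofReal (f x)) :
    0 < RandomGeometricGraph.totalMass N f k ∧ RandomGeometricGraph.totalMass N f k < ∞ ∧
    ∃ ν : ProbabilityMeasure ℝ,
      (∀ x : ℝ, (ν : Measure ℝ).real (Set.Iic x) =
        if x < 0 then
          Real.exp (-((RandomGeometricGraph.totalMass N f k).toReal * (-x) ^ (d * k)))
        else 1) ∧
      TendstoInDistribution
        (fun (n : ℕ) (ω : Ω) => -((n : ℝ) ^ (((k : ℝ) + 1) / ((d : ℝ) * (k : ℝ))) *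
          RandomGeometricGraph.thresholdRadius N k (RandomGeometricGraph.binomialPoints X n ω)))
        atTop (fun z : ℝ => z) (fun _ => P) (ν : Measure ℝ) := by
  obtain ⟨C₀, hC₀⟩ := hf_bdd
  -- truncation makes the density bounded everywhere and changes it on a null set only
  set C : ℝ := max C₀ 1 with hC
  set f' : (Fin d → ℝ) → ℝ := fun x => min (f x) C with hf'
  have hC1 : 1 ≤ C := le_max_right _ _
  have hae : f' =ᵐ[volume] f := by
    filter_upwards [hC₀] with x hx
    exact min_eq_left (hx.trans (le_max_left _ _))
  have hf'm : Measurable f' := hf_meas.min measurable_const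
  have hf'0 : ∀ x, 0 ≤ f' x := fun x => le_min (hf_nonneg x) (by linarith)
  have hf'C : ∀ x, f' x ≤ C := fun x => min_le_right _ _
  have hlaw : ∀ i, P.map (X i) = volume.withDensity fun x => ENNReal.ofReal (f' x) := fun i => by
    rw [hX_law i]
    refine withDensity_congr_ae ?_
    filter_upwards [hae] with x hx
    rw [hx]
  have hmass : RandomGeometricGraph.totalMass N f k = RandomGeometricGraph.totalMass N f' k := by
    rw [RandomGeometricGraph.totalMass_eq hd, RandomGeometricGraph.totalMass_eq hd]
    congr 2
    refine lintegral_congr_ae ?_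
    filter_upwards [hae] with x hx
    rw [hx]
  have hf1 : ∫⁻ x, ENNReal.ofReal (f' x) = 1 := by
    have h : (P.map (X 0)) Set.univ = 1 := by
      rw [Measure.map_apply (hX_meas 0) MeasurableSet.univ, Set.preimage_univ, measure_univ]
    rwa [hlaw, withDensity_apply _ MeasurableSet.univ, setLIntegral_univ] at h
  rw [hmass]
  have hpos := RandomGeometricGraph.totalMass_pos hd N hf'm hf1 k
  have hfin := RandomGeometricGraph.totalMass_lt_top hd N hN hf'm hC1 hf'C hf1 k
  have hdk : d * k ≠ 0 := Nat.mul_ne_zero (by omega) (by omega)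
  refine ⟨hpos, hfin, ?_⟩
  obtain ⟨ν, hν⟩ := RandomGeometricGraph.exists_probabilityMeasure_weibull
    (ENNReal.toReal_pos hpos.ne' hfin.ne) hdk
  have hYm : ∀ n : ℕ, AEMeasurable (fun ω =>
      -((n : ℝ) ^ (((k : ℝ) + 1) / ((d : ℝ) * (k : ℝ))) *
        RandomGeometricGraph.thresholdRadius N k (RandomGeometricGraph.binomialPoints X n ω))) P :=
    fun n => ((RandomGeometricGraph.aemeasurable_thresholdRadius hd N hN hX_meas hX_indep hlaw hk
      n).const_mul _).neg
  refine ⟨ν, fun x => ?_, ⟨hYm, aemeasurable_id, ?_⟩⟩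
  · rw [hν]
    split_ifs with hx
    · rw [max_eq_left (by linarith)]
    · rw [max_eq_right (by linarith), zero_pow hdk]
      simp
  · refine RandomGeometricGraph.tendsto_probabilityMeasure_of_tendsto_Iic fun x => ?_
    simp only [ProbabilityMeasure.coe_mk, Measure.map_id']
    rw [hν]
    refine (RandomGeometricGraph.tendsto_measureReal_neg_thresholdRadius_le hd N hN hf'm hf'0 hC1
      hf'C hX_meas hX_indep hlaw hk x).congr fun n => ?_
    rw [measureReal_def, measureReal_def, Measure.map_apply_of_aemeasurable (hYm n)
      measurableSet_Iic]
    rfl
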